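/- Let $k$ be a commutative ring (for example $k=\mathbb Z$), let $\alpha\colon H\to G$ be a homomorphism of discrete groups, let $A$ be a $k$-module, regarded as a trivial module over every group below, and let $r,s\ge 0$ be integers. Let $k[G]$ be the $k[G^2]$-module with action $(x,y)\cdot c=xcy^{-1}$, and let $I_G\subset k[G]$ be the kernel of the augmentation $k[G]\to k$; tensor products are over $k$ with diagonal action. Put $E_G=\mathrm{Ext}^r_{k[G^2]}(k[G]\otimes I_G^{\otimes s},A)$, and define $E_H$ in the same way. Let $$\alpha^\sharp\colon E_G\to E_H$$ be the map induced by $\alpha$: restrict extension classes along $\alpha\times\alpha\colon H^2\to G^2$, then pull back along $k[H]\otimes I_H^{\otimes s}\to k[G]\otimes I_G^{\otimes s}$, $c\otimes m\mapsto\alpha(c)\otimes\alpha^{\otimes s}(m)$. For a tuple $a=(a_1,\dots,a_s)\in(G\setminus\{1\})^s$ let $O_a$ be its orbit under simultaneous conjugation by $G$, let $C_G(a)$ be the intersection of the centralizers of the $a_i$, and let $$q_a\colon E_G\to H^r(C_G(a);A)$$ be the composite $$E_G\to\mathrm{Ext}^r_{k[G]}(I_G^{\otimes s},A)\to\mathrm{Ext}^r_{k[G]}(k[O_a],A)\to\mathrm{Ext}^r_{k[C_G(a)]}(k,A)=H^r(C_G(a);A).$$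 The first map is the change-of-groups map for the diagonal $G\to G^2$ and $k[G]\otimes I_G^{\otimes s}\cong k[G^2]\otimes_{k[G]}I_G^{\otimes s}$; the second is restriction along $k[O_a]\hookrightarrow I_G^{\otimes s}$, $(t_1,\dots,t_s)\mapsto(t_1-1)\otimes\cdots\otimes(t_s-1)$; the third is the change-of-groups map for $C_G(a)\hookrightarrow G$ and $k[O_a]\cong k[G]\otimes_{k[C_G(a)]}k$. Then the following hold. 1. For every choice of one tuple in each conjugation orbit, the projections $q_a$ at the chosen tuples give an isomorphism $E_G\cong\prod_{O_a}H^r(C_G(a);A)$; likewise for $H$. Consequently for each $a$ there is a unique homomorphism $j_a\colon H^r(C_G(a);A)\to E_G$ with $q_aj_a=\mathrm{id}$ and $q_{t}j_a=0$ for every tuple $t\notin O_a$ (the inclusion of the factor of $O_a$). 2. For $a\in(G\setminus\{1\})^s$ and $b\in(H\setminus\{1\})^s$ let $$\Psi_{a,b}=q_b\circ\alpha^\sharp\circ j_a\colon H^r(C_G(a);A)\to H^r(C_H(b);A).$$ If $\alpha(b)=(\alpha(b_1),\dots,\alpha(b_s))\notin O_a$, then $\Psi_{a,b}=0$. If $\alpha(b)=a$,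 then $\Psi_{a,b}$ is the homomorphism $\alpha^*$ induced on group cohomology by $\alpha\colon C_H(b)\to C_G(a)$. -/

import Mathlib

open CategoryTheory
universe u
noncomputable section
namespace TCExt

/-! ### Group cohomology as an Ext group

`Rep k G` is the category of `k[G]`-modules; for `k = ℤ` these are the `G`-modules. -/

/-- `Rep k G` has enough projectives, hence Ext groups. -/
instance repHasExt (k G : Type u) [CommRing k] [Group G] : HasExt.{u} (Rep.{u} k G) :=
  hasExt_of_enoughProjectives _

section
variable {k G : Type u} [CommRing k] [Group G] (M : Rep.{u} k G) (n : ℕ)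

/-- An inhomogeneous `n`-cochain `Gⁿ → M`, viewed as a morphism from the `n`-th term of the bar
resolution of the trivial module `k` to `M`. -/
def barHom : ((Fin n → G) → M) ≃+ ((Rep.barResolution k G).complex.X n ⟶ M) :=
  (Rep.freeLiftLEquiv k G (Fin n → G) M).symm.toAddEquiv

theorem d_barHom (f : (Fin n → G) → M) :
    (Rep.barResolution k G).complex.d (n + 1) n ≫ barHom M n f
      = barHom M (n + 1) ((groupCohomology.inhomogeneousCochains M).d n (n + 1) f) := by
  have h := (groupCohomology.inhomogeneousCochainsIso M).hom.comm n (n + 1)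
  have h2 := congrArg (fun φ => φ.hom f) h
  exact h2

theorem d_barHom_eq_zero_iff (f : (Fin n → G) → M) :
    (Rep.barResolution k G).complex.d (n + 1) n ≫ barHom M n f = 0 ↔
      inhomogeneousCochains.d M n f = 0 := by
  rw [d_barHom, ← groupCohomology.inhomogeneousCochains.d_def]
  exact map_eq_zero_iff (barHom M (n + 1)) (barHom M (n + 1)).injective

theorem d_iCocycles (z : groupCohomology.cocycles M n) :
    inhomogeneousCochains.d M n (groupCohomology.iCocycles M n z) = 0 := by
  rw [← groupCohomology.inhomogeneousCochains.d_def]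
  exact congrArg (fun φ => φ.hom z)
    ((groupCohomology.inhomogeneousCochains M).iCycles_d n (n + 1))

/-- The inclusion of `n`-cocycles into `n`-cochains. -/
def iCocyclesHom : groupCohomology.cocycles M n →+ ((Fin n → G) → M) :=
  (groupCohomology.iCocycles M n).hom.toAddMonoidHom

theorem iCocyclesHom_injective : Function.Injective (iCocyclesHom M n) :=
  (ModuleCat.mono_iff_injective (groupCohomology.iCocycles M n)).1 inferInstance

/-- The projection from `n`-cocycles to cohomology classes. -/
def piHom : groupCohomology.cocycles M n →+ groupCohomology M n :=
  (groupCohomology.π M n).hom.toAddMonoidHom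

theorem piHom_surjective : Function.Surjective (piHom M n) :=
  (ModuleCat.epi_iff_surjective
    ((groupCohomology.inhomogeneousCochains M).homologyπ n)).1 inferInstance

/-- The class in `Ext^n(k, M)` of an inhomogeneous cocycle, computed by the bar resolution. -/
def extOfCocycle : groupCohomology.cocycles M n →+ Abelian.Ext (Rep.trivial k G k) M n where
  toFun z := (Rep.barResolution k G).extMk (barHom M n (iCocyclesHom M n z)) (n + 1) rfl
    ((d_barHom_eq_zero_iff M n _).2 (d_iCocycles M n z))
  map_zero' := by simp only [map_zero]; exact ProjectiveResolution.extMk_zero _ _ _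
  map_add' x y := by simp only [map_add]; exact (ProjectiveResolution.add_extMk _ _ _ _ _ _ _).symm

theorem extMk_eq_zero_iff_of_zero {C : Type*} [Category C] [Abelian C] [HasExt.{u} C] {X Y : C}
    (R : ProjectiveResolution X) (f : R.complex.X 0 ⟶ Y) (hf : R.complex.d 1 0 ≫ f = 0) :
    R.extMk f 1 rfl hf = 0 ↔ f = 0 := by
  refine ⟨fun h => ?_, fun h => by subst h; simp⟩
  rw [← R.extEquivCohomologyClass.apply_eq_iff_eq,
    ProjectiveResolution.extEquivCohomologyClass_extMk,
    ProjectiveResolution.extEquivCohomologyClass_zero,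
    CochainComplex.HomComplex.CohomologyClass.mk_eq_zero_iff,
    CochainComplex.HomComplex.Cocycle.toSingleMk_mem_coboundaries_iff _ _ _ _ _ 1 (by simp)] at h
  obtain ⟨g, hg⟩ := h
  have h0 : R.cochainComplex.d (-((0 : ℕ) : ℤ)) 1 = 0 := by
    apply (R.cochainComplex.isZero_of_isStrictlyLE 0 1 (by simp)).eq_of_tgt
  rw [h0, Limits.zero_comp] at hg
  rw [← cancel_epi (R.cochainComplexXIso (-((0 : ℕ) : ℤ)) 0 rfl).hom, ← hg, Limits.comp_zero]

theorem extOfCocycle_eq_zero_iff (z : groupCohomology.cocycles M n) :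
    extOfCocycle M n z = 0 ↔ piHom M n z = 0 := by
  have hi := iCocyclesHom_injective M n
  cases n with
  | zero =>
    have h1 : Function.Injective (piHom M 0) :=
      (ModuleCat.mono_iff_injective
        ((groupCohomology.inhomogeneousCochains M).homologyπ 0)).1 inferInstance
    rw [map_eq_zero_iff _ h1]
    refine (extMk_eq_zero_iff_of_zero _ _
      ((d_barHom_eq_zero_iff M 0 _).2 (d_iCocycles M 0 z))).trans ?_
    exact (map_eq_zero_iff _ (barHom M 0).injective).trans (map_eq_zero_iff _ hi)
  | succ n =>
    refine (ProjectiveResolution.extMk_eq_zero_iff _ _ _ rfl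
      ((d_barHom_eq_zero_iff M (n + 1) _).2 (d_iCocycles M (n + 1) z)) n rfl).trans ?_
    have hex : (ShortComplex.mk _ _
        ((groupCohomology.inhomogeneousCochains M).toCycles_comp_homologyπ n (n + 1))).Exact :=
      ShortComplex.exact_of_g_is_cokernel _
        ((groupCohomology.inhomogeneousCochains M).homologyIsCokernel n (n + 1) (by simp))
    rw [ShortComplex.moduleCat_exact_iff] at hex
    have hd : ∀ c, iCocyclesHom M (n + 1) (groupCohomology.toCocycles M n (n + 1) c)
        = (groupCohomology.inhomogeneousCochains M).d n (n + 1) c := fun c =>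
      congrArg (fun φ => φ.hom c) ((groupCohomology.inhomogeneousCochains M).toCycles_i n (n + 1))
    constructor
    · rintro ⟨g, hg⟩
      obtain ⟨c, rfl⟩ := (barHom M n).surjective g
      have h2 := (d_barHom M n c).symm.trans hg
      have h3 := (barHom M (n + 1)).injective h2
      have h4 : z = groupCohomology.toCocycles M n (n + 1) c := hi ((hd c).trans h3).symm
      rw [h4]
      exact congrArg (fun φ => φ.hom c)
        ((groupCohomology.inhomogeneousCochains M).toCycles_comp_homologyπ n (n + 1))
    · intro h
      obtain ⟨c, hc⟩ := hex z h
      refine ⟨barHom M n c, (d_barHom M n c).trans ?_⟩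
      rw [← hd c]
      exact congrArg (fun t => barHom M (n + 1) (iCocyclesHom M (n + 1) t)) hc

theorem extOfCocycle_surjective : Function.Surjective (extOfCocycle M n) := by
  intro e
  obtain ⟨f, hf, rfl⟩ := (Rep.barResolution k G).extMk_surjective e (n + 1) rfl
  obtain ⟨c, rfl⟩ := (barHom M n).surjective f
  have h3 := (d_barHom_eq_zero_iff M n c).1 hf
  refine ⟨groupCohomology.cocyclesMk c h3, ?_⟩
  have h4 : iCocyclesHom M n (groupCohomology.cocyclesMk c h3) = c :=
    groupCohomology.iCocycles_mk c h3
  simp only [extOfCocycle, AddMonoidHom.coe_mk, ZeroHom.coe_mk, h4]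

/-- The identification `H^n(G; M) ≅ Ext^n_{k[G]}(k, M)`, sending the cohomology class of a cocycle
to the extension class it represents on the bar resolution (see the next lemma). -/
def groupCohomologyAddEquivExt :
    groupCohomology M n ≃+ Abelian.Ext (Rep.trivial k G k) M n :=
  ((QuotientAddGroup.quotientKerEquivOfSurjective (piHom M n) (piHom_surjective M n)).symm.trans
    (QuotientAddGroup.quotientAddEquivOfEq (by
      ext z; exact (extOfCocycle_eq_zero_iff M n z).symm))).trans
  (QuotientAddGroup.quotientKerEquivOfSurjective (extOfCocycle M n)
    (extOfCocycle_surjective M n))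

theorem groupCohomologyAddEquivExt_pi (z : groupCohomology.cocycles M n) :
    groupCohomologyAddEquivExt M n (groupCohomology.π M n z) = extOfCocycle M n z := by
  have : (QuotientAddGroup.quotientKerEquivOfSurjective (piHom M n) (piHom_surjective M n)).symm
      (groupCohomology.π M n z) = QuotientAddGroup.mk z := by
    rw [AddEquiv.symm_apply_eq]; rfl
  simp only [groupCohomologyAddEquivExt, AddEquiv.trans_apply, this]
  rfl
end

/-! ### Change of groups for Ext -/

section ChangeOfGroups
open Abelian
variable {k G H : Type u} [CommRing k] [Group G] [Group H] (α : H →* G)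

/-- The homomorphism `Φ_α : Ext^n_G(F_α M, N) → Ext^n_H(M, U_α N)` induced on Ext groups by the
adjunction between induction `F_α` and restriction `U_α` along `α : H → G`: restrict an extension
class along `α` (restriction is exact), then pull it back along the unit `M → U_α F_α M`. -/
def extPhi (M : Rep.{u} k H) (N : Rep.{u} k G) (n : ℕ) :
    Ext ((Rep.indFunctor.{u} k α).obj M) N n →+ Ext M ((Rep.resFunctor α).obj N) n where
  toFun e := (Ext.mk₀ ((Rep.indResAdjunction.{u} k α).unit.app M)).comp
    (e.mapExactFunctor (Rep.resFunctor α)) (zero_add n)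
  map_zero' := by simp
  map_add' x y := by simp

/-- Precomposition `f^* : Ext^n(Y, N) → Ext^n(X, N)` with a morphism `f : X → Y`. -/
def extPre {C : Type*} [Category C] [Abelian C] [HasExt.{u} C] {X Y : C} (f : X ⟶ Y) (N : C)
    (n : ℕ) : Ext.{u} Y N n →+ Ext.{u} X N n where
  toFun e := (Ext.mk₀ f).comp e (zero_add n)
  map_zero' := by simp
  map_add' x y := by simp

/-- The homomorphism `Θ_α : Ext^n_G(M, N) → Ext^n_H(U_α M, U_α N)`, the composite of the pullback
along the counit `F_α U_α M → M` with `Φ_α`. -/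
def extTheta (M N : Rep.{u} k G) (n : ℕ) :
    Ext M N n →+ Ext ((Rep.resFunctor α).obj M) ((Rep.resFunctor α).obj N) n :=
  (extPhi α ((Rep.resFunctor α).obj M) N n).comp
    (extPre ((Rep.indResAdjunction.{u} k α).counit.app M) N n)

end ChangeOfGroups

/-! ### The modules and the decomposition over conjugation orbits -/

section Modules
open MonoidalCategory
open scoped MonoidAlgebra TensorProduct

variable (k : Type u) [CommRing k]

/-- A copy of the set `G`, with `G × G` acting by `(a, b) • c = a * c * b⁻¹`. -/
@[ext]
structure TwoSided (G : Type u) : Type u where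
  val : G

instance (G : Type u) [Group G] : MulAction (G × G) (TwoSided G) where
  smul p c := ⟨p.1 * c.val * p.2⁻¹⟩
  one_smul c := TwoSided.ext (show 1 * c.val * 1⁻¹ = c.val by simp)
  mul_smul p q c := TwoSided.ext (show (p.1 * q.1) * c.val * (p.2 * q.2)⁻¹
    = p.1 * (q.1 * c.val * q.2⁻¹) * p.2⁻¹ by group)

theorem TwoSided.smul_def {G : Type u} [Group G] (p : G × G) (c : TwoSided G) :
    p • c = ⟨p.1 * c.val * p.2⁻¹⟩ := rfl

/-- The `G²`-module `k[G]`, with `(a, b) • c = a c b⁻¹`. -/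
abbrev twoSidedRep (G : Type u) [Group G] : Rep.{u} k (G × G) :=
  Rep.ofMulAction k (G × G) (TwoSided G)

/-- The augmentation `k[G] → k`, the sum of the coefficients. -/
def augmentation (G : Type u) : MonoidAlgebra k (TwoSided G) →ₗ[k] k :=
  (Finsupp.linearCombination k (fun _ : TwoSided G => (1 : k))) ∘ₗ
    (MonoidAlgebra.coeffLinearEquiv k).toLinearMap

theorem augmentation_single (G : Type u) (g : TwoSided G) (r : k) :
    augmentation k G (MonoidAlgebra.single g r) = r := by
  simp [augmentation]

theorem augmentation_comp (G : Type u) [Group G] (p : G × G) :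
    augmentation k G ∘ₗ (twoSidedRep k G).ρ p = augmentation k G := by
  ext c
  simp [augmentation_single]

/-- The augmentation ideal `I_G`, as a `G²`-submodule of `k[G]`. -/
abbrev augIdeal (G : Type u) [Group G] : Rep.{u} k (G × G) :=
  Rep.subrepresentation (twoSidedRep k G) (LinearMap.ker (augmentation k G)) (fun p x hx => by
    rw [Submodule.mem_comap, LinearMap.mem_ker, ← LinearMap.comp_apply, augmentation_comp]
    exact hx)

/-- The tensor power `I_G^{⊗ s}` with the diagonal `G²`-action. -/
def augPow (G : Type u) [Group G] : ℕ → Rep.{u} k (G × G)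
  | 0 => Rep.trivial k (G × G) k
  | s + 1 => augIdeal k G ⊗ augPow G s

/-- The `G²`-module `k[G] ⊗ I_G^{⊗ s}` with the diagonal action. -/
def middleModule (G : Type u) [Group G] (s : ℕ) : Rep.{u} k (G × G) :=
  twoSidedRep k G ⊗ augPow k G s

section Functoriality
variable {G H : Type u} [Group G] [Group H] (α : H →* G)

/-- The homomorphism `α² = α × α : H² → G²`. -/
def sq : H × H →* G × G := α.prodMap α

/-- The map `H → G` underlying `α`. -/
def TwoSided.map (c : TwoSided H) : TwoSided G := ⟨α c.val⟩

theorem TwoSided.map_smul (p : H × H) (c : TwoSided H) :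
    TwoSided.map α (p • c) = sq α p • TwoSided.map α c := by
  simp [TwoSided.map, TwoSided.smul_def, sq]

/-- The linear map `k[H] → k[G]` induced by `α`. -/
def groupRingMap : MonoidAlgebra k (TwoSided H) →ₗ[k] MonoidAlgebra k (TwoSided G) :=
  MonoidAlgebra.mapDomainLinearMap k k (TwoSided.map α)

theorem groupRingMap_comp (p : H × H) :
    groupRingMap k α ∘ₗ (twoSidedRep k H).ρ p = (twoSidedRep k G).ρ (sq α p) ∘ₗ groupRingMap k α := by
  ext c
  simp [groupRingMap, TwoSided.map_smul]

theorem augmentation_groupRingMap (x : MonoidAlgebra k (TwoSided H)) :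
    augmentation k G (groupRingMap k α x) = augmentation k H x := by
  rw [← LinearMap.comp_apply]
  congr 1
  ext c
  simp [groupRingMap, augmentation_single]

/-- `k[H] → k[G]` as an `H²`-morphism to the restriction of `k[G]` along `α²`. -/
def twoSidedMap : twoSidedRep k H ⟶ (Rep.resFunctor (sq α)).obj (twoSidedRep k G) :=
  Rep.ofHom ⟨groupRingMap k α, groupRingMap_comp k α⟩

/-- `I_H → I_G`, the restriction of `k[H] → k[G]`. -/
def augIdealMap : augIdeal k H ⟶ (Rep.resFunctor (sq α)).obj (augIdeal k G) :=
  Rep.ofHom ⟨(groupRingMap k α).restrict (fun x hx => by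
    rw [LinearMap.mem_ker] at hx ⊢
    rw [augmentation_groupRingMap, hx]), fun p => by
      refine LinearMap.ext fun x => Subtype.ext ?_
      exact LinearMap.congr_fun (groupRingMap_comp k α p) x.1⟩

/-- The tensor product of two morphisms into restricted modules. -/
def resTensorMap {Γ Γ' : Type u} [Group Γ] [Group Γ'] (β : Γ' →* Γ) {M₁ M₂ : Rep.{u} k Γ'}
    {N₁ N₂ : Rep.{u} k Γ} (f : M₁ ⟶ (Rep.resFunctor β).obj N₁)
    (g : M₂ ⟶ (Rep.resFunctor β).obj N₂) : M₁ ⊗ M₂ ⟶ (Rep.resFunctor β).obj (N₁ ⊗ N₂) :=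
  Rep.ofHom ⟨TensorProduct.map f.hom.toLinearMap g.hom.toLinearMap, fun p =>
    TensorProduct.ext' fun x y => congrArg₂ (TensorProduct.tmul k)
      (Rep.hom_comm_apply f p x) (Rep.hom_comm_apply g p y)⟩

/-- The morphism `h_s : I_H^{⊗ s} → I_G^{⊗ s}`, the `s`-fold tensor power of `I_H → I_G`. -/
def augPowMap : (s : ℕ) → (augPow k H s ⟶ (Rep.resFunctor (sq α)).obj (augPow k G s))
  | 0 => 𝟙 (Rep.trivial k (H × H) k)
  | s + 1 => resTensorMap k (sq α) (augIdealMap k α) (augPowMap s)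

/-- The morphism `k[H] ⊗ I_H^{⊗ s} → k[G] ⊗ I_G^{⊗ s}`, `c ⊗ m ↦ α(c) ⊗ h_s(m)`. -/
def middleHom (s : ℕ) :
    middleModule k H s ⟶ (Rep.resFunctor (sq α)).obj (middleModule k G s) :=
  resTensorMap k (sq α) (twoSidedMap k α) (augPowMap k α s)

/-- The map `Ext^r_{G²}(k[G] ⊗ I_G^{⊗ s}, A) → Ext^r_{H²}(k[H] ⊗ I_H^{⊗ s}, A)` induced by `α`, for a
trivial module `A`: apply `Θ` for `α²`, then pull back along
`k[H] ⊗ I_H^{⊗ s} → k[G] ⊗ I_G^{⊗ s}`. -/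
def middleMap (A : Type u) [AddCommGroup A] [Module k A] (s r : ℕ) :
    Abelian.Ext (middleModule k G s) (Rep.trivial k (G × G) A) r →+
      Abelian.Ext (middleModule k H s) (Rep.trivial k (H × H) A) r :=
  (extPre (middleHom k α s) (Rep.trivial k (H × H) A) r).comp
    (extTheta (sq α) (middleModule k G s) (Rep.trivial k (G × G) A) r)

end Functoriality

section Summands
variable (G : Type u) [Group G]

/-- The diagonal inclusion `Δ : G → G²`. -/
def diag : G →* G × G := (MonoidHom.id G).prod (MonoidHom.id G)

/-- The `G`-morphism `U_Δ N → U_Δ (k[G] ⊗ N)`, `n ↦ 1 ⊗ n`. -/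
def diagUnit (N : Rep.{u} k (G × G)) :
    (Rep.resFunctor (diag G)).obj N ⟶ (Rep.resFunctor (diag G)).obj (twoSidedRep k G ⊗ N) :=
  Rep.ofHom ⟨TensorProduct.mk k (twoSidedRep k G) N (MonoidAlgebra.single ⟨1⟩ 1), fun g => by
    ext x
    simp [diag, TwoSided.smul_def]⟩

/-- The canonical morphism `F_Δ U_Δ N → k[G] ⊗ N` identifying the two modules, adjoint to
`n ↦ 1 ⊗ n`; that is, `(a, b) ⊗ n ↦ a b⁻¹ ⊗ (a, b) n`. -/
def diagHom (N : Rep.{u} k (G × G)) :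
    (Rep.indFunctor.{u} k (diag G)).obj ((Rep.resFunctor (diag G)).obj N) ⟶ twoSidedRep k G ⊗ N :=
  ((Rep.indResAdjunction.{u} k (diag G)).homEquiv _ _).symm (diagUnit k G N)

/-- The set `G ∖ {1}`, on which `G` acts by conjugation. -/
@[ext]
structure NontrivialElt where
  val : G
  ne_one : val ≠ 1

instance : MulAction G (NontrivialElt G) where
  smul g c := ⟨g * c.val * g⁻¹, by simpa using c.ne_one⟩
  one_smul c := NontrivialElt.ext (show 1 * c.val * 1⁻¹ = c.val by simp)
  mul_smul g h c := NontrivialElt.ext (show (g * h) * c.val * (g * h)⁻¹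
    = g * (h * c.val * h⁻¹) * g⁻¹ by group)

/-- The set `(G ∖ {1})^s`, with `G` acting by simultaneous conjugation. -/
abbrev Tuple (s : ℕ) : Type u := Fin s → NontrivialElt G

variable {G}

theorem NontrivialElt.smul_val (g : G) (c : NontrivialElt G) : (g • c).val = g * c.val * g⁻¹ := rfl

/-- The element `g - 1` of `I_G`. -/
def subOne (g : G) : augIdeal k G :=
  ⟨MonoidAlgebra.single ⟨g⟩ 1 - MonoidAlgebra.single ⟨1⟩ 1, by
    rw [LinearMap.mem_ker, map_sub, augmentation_single, augmentation_single, sub_self]⟩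

/-- The element `(t₁ - 1) ⊗ ⋯ ⊗ (t_s - 1)` of `I_G^{⊗ s}`. -/
def basisTensor : (s : ℕ) → (Fin s → G) → augPow k G s
  | 0, _ => (1 : k)
  | s + 1, t => TensorProduct.tmul k (subOne k (t 0)) (basisTensor s (Fin.tail t))

theorem subOne_smul (g x : G) :
    (augIdeal k G).ρ (g, g) (subOne k x) = subOne k (g * x * g⁻¹) := by
  apply Subtype.ext
  change (twoSidedRep k G).ρ (g, g) (_ - _) = _ - _
  rw [map_sub]
  simp [TwoSided.smul_def]

theorem basisTensor_smul (g : G) : ∀ (s : ℕ) (t : Fin s → G),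
    (augPow k G s).ρ (g, g) (basisTensor k s t) = basisTensor k s (fun i => g * t i * g⁻¹)
  | 0, _ => rfl
  | s + 1, t => by
    change TensorProduct.tmul k ((augIdeal k G).ρ (g, g) (subOne k (t 0)))
      ((augPow k G s).ρ (g, g) (basisTensor k s (Fin.tail t))) = _
    rw [subOne_smul, basisTensor_smul]
    rfl

/-- The permutation module `k[O_a]` on the conjugation orbit `O_a` of the tuple `a`. -/
abbrev orbitRep {s : ℕ} (a : Tuple G s) : Rep.{u} k G :=
  Rep.ofMulAction k G (MulAction.orbit G a)

/-- The inclusion `k[O_a] → U_Δ I_G^{⊗ s}`, `(t₁, …, t_s) ↦ (t₁ - 1) ⊗ ⋯ ⊗ (t_s - 1)`, of the summand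
of `U_Δ I_G^{⊗ s} ≅ ⨁_O k[O]` belonging to the orbit of `a`. -/
def orbitIncl {s : ℕ} (a : Tuple G s) :
    orbitRep k a ⟶ (Rep.resFunctor (diag G)).obj (augPow k G s) :=
  Rep.ofHom ⟨(Finsupp.linearCombination k
      (fun o : MulAction.orbit G a => basisTensor k s (fun i => (o.1 i).val))) ∘ₗ
      (MonoidAlgebra.coeffLinearEquiv k).toLinearMap, fun g => by
    ext o
    simp
    exact (basisTensor_smul k g s _).symm⟩

/-- The centralizer `C_G(a)` of a tuple `a`, the set of elements commuting with all its entries. -/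
def tupleCentralizer {s : ℕ} (a : Tuple G s) : Subgroup G :=
  Subgroup.centralizer (Set.range fun i => (a i).val)

/-- The `C_G(a)`-morphism `k → k[O_a]`, `1 ↦ a`. -/
def orbitUnit {s : ℕ} (a : Tuple G s) :
    Rep.trivial k (tupleCentralizer a) k ⟶
      (Rep.resFunctor (tupleCentralizer a).subtype).obj (orbitRep k a) :=
  Rep.ofHom ⟨LinearMap.toSpanSingleton k _ (MonoidAlgebra.single ⟨a, MulAction.mem_orbit_self a⟩ 1),
    fun g => by
      refine LinearMap.ext_ring ?_
      have h : g • (⟨a, MulAction.mem_orbit_self a⟩ : MulAction.orbit G a)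
          = ⟨a, MulAction.mem_orbit_self a⟩ := by
        refine Subtype.ext (funext fun i => NontrivialElt.ext ?_)
        change (g : G) * (a i).val * (g : G)⁻¹ = (a i).val
        rw [← Subgroup.mem_centralizer_iff.1 g.2 (a i).val ⟨i, rfl⟩, mul_inv_cancel_right]
      change LinearMap.toSpanSingleton k _ _ (1 : k) =
        (orbitRep k a).ρ (g : G) (LinearMap.toSpanSingleton k _ _ (1 : k))
      rw [LinearMap.toSpanSingleton_apply, one_smul, Representation.ofMulAction_single]
      exact congrArg (fun o => MonoidAlgebra.single o (1 : k)) h.symm⟩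

/-- The canonical morphism `F_ι k → k[O_a]`, `g ⊗ 1 ↦ g • a`, identifying the two modules, where `ι` is
the inclusion of `C_G(a)` in `G`. -/
def orbitHom {s : ℕ} (a : Tuple G s) :
    (Rep.indFunctor.{u} k (tupleCentralizer a).subtype).obj (Rep.trivial k (tupleCentralizer a) k) ⟶
      orbitRep k a :=
  ((Rep.indResAdjunction.{u} k (tupleCentralizer a).subtype).homEquiv _ _).symm (orbitUnit k a)

variable (A : Type u) [AddCommGroup A] [Module k A]

/-- The map `Ext^r_{G²}(k[G] ⊗ I_G^{⊗ s}, A) → Ext^r_G(U_Δ I_G^{⊗ s}, A)` given by `Φ_Δ`. -/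
def diagIso (s r : ℕ) :
    Abelian.Ext (middleModule k G s) (Rep.trivial k (G × G) A) r →+
      Abelian.Ext ((Rep.resFunctor (diag G)).obj (augPow k G s)) (Rep.trivial k G A) r :=
  (extPhi (diag G) ((Rep.resFunctor (diag G)).obj (augPow k G s)) (Rep.trivial k (G × G) A) r).comp
    (extPre (diagHom k G (augPow k G s)) (Rep.trivial k (G × G) A) r)

/-- The map `Ext^r_G(k[O_a], A) → Ext^r_{C_G(a)}(k, A) = H^r(C_G(a); A)` given by `Φ_ι`, where `ι` is
the inclusion of `C_G(a)` in `G`. -/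
def orbitIso {s : ℕ} (a : Tuple G s) (r : ℕ) :
    Abelian.Ext (orbitRep k a) (Rep.trivial k G A) r →+
      groupCohomology (Rep.trivial k (tupleCentralizer a) A) r :=
  (groupCohomologyAddEquivExt (Rep.trivial k (tupleCentralizer a) A) r).symm.toAddMonoidHom.comp
    ((extPhi (tupleCentralizer a).subtype (Rep.trivial k (tupleCentralizer a) k)
      (Rep.trivial k G A) r).comp
    (extPre (orbitHom k a) (Rep.trivial k G A) r))

/-- The projection `q_a : Ext^r_{G²}(k[G] ⊗ I_G^{⊗ s}, A) → H^r(C_G(a); A)` to the factor of the orbit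
of `a`: the composite of `Φ_Δ`, of the restriction to the summand `k[O_a]`, and of `Φ_ι`. -/
def summandProj {s : ℕ} (a : Tuple G s) (r : ℕ) :
    Abelian.Ext (middleModule k G s) (Rep.trivial k (G × G) A) r →+
      groupCohomology (Rep.trivial k (tupleCentralizer a) A) r :=
  (orbitIso k A a r).comp ((extPre (orbitIncl k a) (Rep.trivial k G A) r).comp (diagIso k A s r))

/-- The map `Ext^r_{G²}(k[G] ⊗ I_G^{⊗ s}, A) → ∏_O H^r(C_G(σ O); A)` with components `q_{σ O}`, where
`O` runs over the conjugation orbits and `σ` chooses a tuple for each orbit. -/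
def orbitDecomposition {s : ℕ} (σ : MulAction.orbitRel.Quotient G (Tuple G s) → Tuple G s) (r : ℕ) :
    Abelian.Ext (middleModule k G s) (Rep.trivial k (G × G) A) r →+
      ((O : MulAction.orbitRel.Quotient G (Tuple G s)) →
        groupCohomology (Rep.trivial k (tupleCentralizer (σ O)) A) r) :=
  AddMonoidHom.pi fun O => summandProj k A (σ O) r

/-- `j` is the inclusion `j_a` of the factor `H^r(C_G(a); A)` of the orbit of `a`: its component at `a`
is the identity and its components at the tuples of all other orbits vanish. -/
def IsSummandIncl {s : ℕ} (a : Tuple G s) (r : ℕ)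
    (j : groupCohomology (Rep.trivial k (tupleCentralizer a) A) r →+
      Abelian.Ext (middleModule k G s) (Rep.trivial k (G × G) A) r) : Prop :=
  (summandProj k A a r).comp j = AddMonoidHom.id _ ∧
    ∀ t : Tuple G s, t ∉ MulAction.orbit G a → (summandProj k A t r).comp j = 0

end Summands

section Component
variable {G H : Type u} [Group G] [Group H] (α : H →* G) (A : Type u) [AddCommGroup A] [Module k A]

/-- The component `Ψ_{a,b} = q_b ∘ middleMap ∘ j_a : H^r(C_G(a); A) → H^r(C_H(b); A)`. -/
def component {s : ℕ} {a : Tuple G s} (b : Tuple H s) (r : ℕ)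
    (j : groupCohomology (Rep.trivial k (tupleCentralizer a) A) r →+
      Abelian.Ext (middleModule k G s) (Rep.trivial k (G × G) A) r) :
    groupCohomology (Rep.trivial k (tupleCentralizer a) A) r →+
      groupCohomology (Rep.trivial k (tupleCentralizer b) A) r :=
  (summandProj k A b r).comp ((middleMap k α A s r).comp j)

variable {s : ℕ} {a : Tuple G s} {b : Tuple H s} (h : ∀ i, α (b i).val = (a i).val)

/-- The homomorphism `C_H(b) → C_G(a)` obtained by restricting `α` when `α(b) = a`. -/
def centralizerMap : tupleCentralizer b →* tupleCentralizer a :=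
  (α.comp (tupleCentralizer b).subtype).codRestrict (tupleCentralizer a) (by
    rintro ⟨x, hx⟩
    refine Subgroup.mem_centralizer_iff.2 ?_
    rintro _ ⟨i, rfl⟩
    have hc := Subgroup.mem_centralizer_iff.1 hx (b i).val ⟨i, rfl⟩
    change (a i).val * α x = α x * (a i).val
    rw [← h i, ← map_mul, ← map_mul, hc])

/-- The homomorphism `α^* : H^r(C_G(a); A) → H^r(C_H(b); A)` induced on group cohomology by
`α : C_H(b) → C_G(a)`, when `α(b) = a`. -/
def centralizerRes (r : ℕ) :
    groupCohomology (Rep.trivial k (tupleCentralizer a) A) r →+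
      groupCohomology (Rep.trivial k (tupleCentralizer b) A) r :=
  (groupCohomology.map (A := Rep.trivial k (tupleCentralizer a) A)
    (B := Rep.trivial k (tupleCentralizer b) A) (centralizerMap α h)
    (Rep.ofHom ⟨LinearMap.id, fun _ => rfl⟩) r).hom.toAddMonoidHom

end Component
end Modules
end TCExt
end

/-! The argument rests on the observation that every map in the statement is, on extension classes,
one operation: restrict a class along an exact functor `F` and pull it back along a morphism
`u : Y ⟶ F.obj X` (`extPullback F u`). The adjunctions used to define `Φ` and `Θ` disappear in this
description, by the triangle identities (`extPhi_extPre_homEquiv_symm`, `middleMap_apply`). Since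
restriction of extension classes is natural in the exact functor (`mapExactFunctor_naturality`), two
successive operations of this kind merge into one (`extPullback_extPullback`). Consequently `q_a` is
the restriction along `C_G(a) → G → G²` followed by the pullback along
`1 ↦ 1 ⊗ (a₁ - 1) ⊗ ⋯ ⊗ (a_s - 1)` (`groupCohomologyAddEquivExt_summandProj`).

The decomposition holds in degree `0` because the tensors `(t₁ - 1) ⊗ ⋯ ⊗ (t_s - 1)` with `t_i ≠ 1`
form a basis of `I_G^{⊗ s}` which `G` permutes: morphisms from `k[G] ⊗ I_G^{⊗ s}` to `N` are the
same as families of `C_G(a)`-invariants of `N`, one for each orbit (`middleUnit_comp_bijective`). It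
holds in all degrees by dimension shifting along injective coefficient modules
(`extPullback_bijective`), because restriction to a subgroup preserves injectives
(`resFunctor_preservesInjectiveObjects`); this replaces Shapiro's lemma and the compatibility of Ext
with coproducts. Translation by `(g, g)` identifies the restrictions attached to conjugate tuples,
and acts as the identity on trivial coefficients. Hence the vanishing of `q_t` depends only on the
orbit of `t` (`summandProj_eq_zero_of_mem_orbit`), which gives `j_a`.

For the components, `q_b ∘ α^♯` is the restriction along `C_H(b) → G → G²` followed by the pullback
along `1 ↦ 1 ⊗ (α(b₁) - 1) ⊗ ⋯ ⊗ (α(b_s) - 1)`. If some `α(b_i) = 1` this tensor vanishes. Otherwise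
the restriction factors through `q_{α(b)}`, followed by the restriction of extension classes of
trivial modules along `C_H(b) → C_G(α(b))`; the latter is the usual map in group cohomology
(`groupCohomologyAddEquivExt_map`), as one sees by comparing bar resolutions
(`mk₀_comp_mapExactFunctor_extMk`). Thus `q_b ∘ α^♯ = α^* ∘ q_{α(b)}`, and both claims follow. -/

noncomputable section
namespace TCExt

/-! ### Exact functors and Ext groups -/

section AbstractExt
open Limits Abelian
universe w w' w'' v v' v'' u₁ u₁' u₁'' t

variable {C : Type u₁} [Category.{v} C] [Abelian C] [HasExt.{w} C]
  {D : Type u₁'} [Category.{v'} D] [Abelian D] [HasExt.{w'} D]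
  {E : Type u₁''} [Category.{v''} E] [Abelian E] [HasExt.{w''} E]

/-- The action of exact functors on Ext groups is natural in the functor. Taking for `τ` an
isomorphism or an identity, this compares the restriction along a composite functor with the
composite of the restrictions. -/
theorem mapExactFunctor_naturality [EnoughProjectives C]
    (F : C ⥤ D) [F.Additive] [PreservesFiniteLimits F] [PreservesFiniteColimits F]
    (F' : D ⥤ E) [F'.Additive] [PreservesFiniteLimits F'] [PreservesFiniteColimits F']
    (K : C ⥤ E) [K.Additive] [PreservesFiniteLimits K] [PreservesFiniteColimits K]
    (τ : F ⋙ F' ⟶ K) {X Y : C} {n : ℕ} (e : Ext X Y n) :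
    ((e.mapExactFunctor F).mapExactFunctor F').comp (Ext.mk₀ (τ.app Y)) (add_zero n) =
      (Ext.mk₀ (τ.app X)).comp (e.mapExactFunctor K) (zero_add n) := by
  induction n generalizing X with
  | zero =>
    obtain ⟨f, rfl⟩ := (Ext.mk₀_bijective X Y).2 e
    simp only [Ext.mapExactFunctor_mk₀, Ext.mk₀_comp_mk₀]
    exact congrArg Ext.mk₀ (τ.naturality f)
  | succ n ih =>
    -- write `e` as the product of the class of `0 → K → P → X → 0`, with `P` projective, with a
    -- class of smaller degree
    let P : ProjectivePresentation X := Classical.arbitrary _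
    let S := ShortComplex.mk _ _ (kernel.condition P.f)
    have hS : S.ShortExact := { exact := ShortComplex.exact_kernel P.f }
    have hP : Projective S.X₂ := P.projective
    obtain ⟨e', rfl⟩ := Ext.contravariant_sequence_exact₃ hS Y e
      ((Ext.subsingleton_of_projective S.X₂ Y n).elim _ _) (add_comm 1 n)
    let φ : (S.map F).map F' ⟶ S.map K :=
      { τ₁ := τ.app S.X₁, τ₂ := τ.app S.X₂, τ₃ := τ.app S.X₃
        comm₁₂ := (τ.naturality S.f).symm, comm₂₃ := (τ.naturality S.g).symm }
    have h : ((hS.extClass.mapExactFunctor F).mapExactFunctor F').comp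
        (Ext.mk₀ (τ.app S.X₁)) (add_zero 1) =
        (Ext.mk₀ (τ.app S.X₃)).comp (hS.extClass.mapExactFunctor K) (zero_add 1) := by
      rw [Ext.mapExactFunctor_extClass, Ext.mapExactFunctor_extClass]
      erw [Ext.mapExactFunctor_extClass]
      exact ShortComplex.ShortExact.extClass_naturality ((hS.map_of_exact F).map_of_exact F')
        (hS.map_of_exact K) φ
    rw [Ext.mapExactFunctor_comp, Ext.mapExactFunctor_comp, Ext.mapExactFunctor_comp,
      Ext.comp_assoc_of_third_deg_zero, ih, ← Ext.comp_assoc_of_second_deg_zero, h]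
    exact Ext.comp_assoc _ _ _ (zero_add 1) (add_comm 1 n) (by lia)

/-- Restriction of Ext classes along an exact functor `F`, followed by the pullback along a morphism
`u : Y ⟶ F.obj X`. -/
def extPullback (F : C ⥤ D) [F.Additive] [PreservesFiniteLimits F] [PreservesFiniteColimits F]
    {X : C} {Y : D} (u : Y ⟶ F.obj X) (N : C) (n : ℕ) : Ext X N n →+ Ext Y (F.obj N) n :=
  ((Ext.mk₀ u).precomp (F.obj N) (zero_add n)).comp (F.mapExtAddHom X N n)

theorem extPullback_apply (F : C ⥤ D) [F.Additive] [PreservesFiniteLimits F]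
    [PreservesFiniteColimits F] {X : C} {Y : D} (u : Y ⟶ F.obj X) (N : C) (n : ℕ)
    (e : Ext X N n) :
    extPullback F u N n e = (Ext.mk₀ u).comp (e.mapExactFunctor F) (zero_add n) := rfl

theorem extPullback_comp (F : C ⥤ D) [F.Additive] [PreservesFiniteLimits F]
    [PreservesFiniteColimits F] {X : C} {Y : D} (u : Y ⟶ F.obj X) {N N' : C} {a b c : ℕ}
    (e : Ext X N a) (e' : Ext N N' b) (h : a + b = c) :
    extPullback F u N' c (e.comp e' h) =
      (extPullback F u N a e).comp (e'.mapExactFunctor F) h := by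
  rw [extPullback_apply, extPullback_apply, Ext.mapExactFunctor_comp,
    Ext.comp_assoc _ _ _ _ _ (by lia)]

theorem extPullback_comp_mk₀ (F : C ⥤ D) [F.Additive] [PreservesFiniteLimits F]
    [PreservesFiniteColimits F] {X : C} {Y : D} (u : Y ⟶ F.obj X) {X' N : C} (f : X ⟶ X') (n : ℕ)
    (e : Ext X' N n) :
    extPullback F u N n ((Ext.mk₀ f).comp e (zero_add n)) =
      extPullback F (u ≫ F.map f) N n e := by
  simp only [extPullback_apply, Ext.mapExactFunctor_comp, Ext.mapExactFunctor_mk₀,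
    ← Ext.mk₀_comp_mk₀]
  exact (Ext.comp_assoc _ _ _ _ _ (by lia)).symm

theorem extPullback_zero (F : C ⥤ D) [F.Additive] [PreservesFiniteLimits F]
    [PreservesFiniteColimits F] {X : C} {Y : D} (N : C) (n : ℕ) :
    extPullback F (0 : Y ⟶ F.obj X) N n = 0 := by
  ext e
  rw [extPullback_apply, Ext.mk₀_zero, Ext.zero_comp, AddMonoidHom.zero_apply]

theorem mk₀_comp_extPullback (F : C ⥤ D) [F.Additive] [PreservesFiniteLimits F]
    [PreservesFiniteColimits F] {X : C} {Y Y' : D} (v : Y' ⟶ Y) (u : Y ⟶ F.obj X) (N : C) (n : ℕ)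
    (e : Ext X N n) :
    (Ext.mk₀ v).comp (extPullback F u N n e) (zero_add n) = extPullback F (v ≫ u) N n e := by
  rw [extPullback_apply, extPullback_apply, Ext.mk₀_comp_mk₀_assoc]

/-- Two successive restrictions amount to a single one along `K`, up to a natural transformation
from the composite functor to `K`. -/
theorem extPullback_extPullback_comp [EnoughProjectives C]
    (F : C ⥤ D) [F.Additive] [PreservesFiniteLimits F] [PreservesFiniteColimits F]
    (F' : D ⥤ E) [F'.Additive] [PreservesFiniteLimits F'] [PreservesFiniteColimits F']
    (K : C ⥤ E) [K.Additive] [PreservesFiniteLimits K] [PreservesFiniteColimits K]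
    (τ : F ⋙ F' ⟶ K) {X : C} {Y : D} {Z : E} (u : Y ⟶ F.obj X) (w : Z ⟶ F'.obj Y) (N : C) (n : ℕ)
    (e : Ext X N n) :
    (extPullback F' w (F.obj N) n (extPullback F u N n e)).comp (Ext.mk₀ (τ.app N)) (add_zero n) =
      extPullback K (w ≫ F'.map u ≫ τ.app X) N n e := by
  have h := mapExactFunctor_naturality F F' K τ e
  have h1 : extPullback F' w (F.obj N) n (extPullback F u N n e) =
      (Ext.mk₀ (w ≫ F'.map u)).comp ((e.mapExactFunctor F).mapExactFunctor F') (zero_add n) := by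
    rw [extPullback_apply F u, extPullback_comp_mk₀, extPullback_apply]
  rw [h1, Ext.comp_assoc_of_third_deg_zero]
  refine (congrArg (fun t => (Ext.mk₀ (w ≫ F'.map u)).comp t (zero_add n)) h).trans ?_
  rw [extPullback_apply]
  exact (Ext.mk₀_comp_mk₀_assoc _ _ _).trans (by rw [Category.assoc])

/-- If a family of morphisms `u i : Y i ⟶ (F i).obj X` exhibits `X` as a coproduct of objects
induced from the `Y i`, in the sense that it has the corresponding universal property for morphisms,
then it does so for Ext groups in all degrees, provided that the exact functors `F i` preserve
injectives. This is Shapiro's lemma and the compatibility of Ext with coproducts in one statement;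
the proof is by dimension shifting in the second variable. -/
theorem extPullback_bijective [EnoughInjectives C] {ι : Type t}
    {D : ι → Type u₁'} [∀ i, Category.{v'} (D i)] [∀ i, Abelian (D i)] [∀ i, HasExt.{w'} (D i)]
    (F : ∀ i, C ⥤ D i) [∀ i, (F i).Additive] [∀ i, PreservesFiniteLimits (F i)]
    [∀ i, PreservesFiniteColimits (F i)] [∀ i, (F i).PreservesInjectiveObjects]
    {X : C} {Y : ∀ i, D i} (u : ∀ i, Y i ⟶ (F i).obj X)
    (hu : ∀ N : C, Function.Bijective fun (f : X ⟶ N) i => u i ≫ (F i).map f) (N : C) (n : ℕ) :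
    Function.Bijective (AddMonoidHom.pi fun i => extPullback (F i) (u i) N n) := by
  induction n generalizing N with
  | zero =>
    have h0 : ∀ f : X ⟶ N, (AddMonoidHom.pi fun i => extPullback (F i) (u i) N 0) (Ext.mk₀ f) =
        fun i => Ext.mk₀ (u i ≫ (F i).map f) := fun f => funext fun i => by
      simp [extPullback_apply, Ext.mapExactFunctor_mk₀]
    constructor
    · intro e e' h
      obtain ⟨f, rfl⟩ := (Ext.mk₀_bijective X N).2 e
      obtain ⟨f', rfl⟩ := (Ext.mk₀_bijective X N).2 e'
      rw [h0, h0] at h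
      exact congrArg _ ((hu N).1 (funext fun i => (Ext.mk₀_bijective _ _).1 (congrFun h i)))
    · intro e
      choose g hg using fun i => (Ext.mk₀_bijective _ _).2 (e i)
      obtain ⟨f, hf⟩ := (hu N).2 g
      refine ⟨Ext.mk₀ f, ?_⟩
      rw [h0]
      funext i
      rw [← hg i]
      exact congrArg _ (congrFun hf i)
  | succ n ih =>
    let I : InjectivePresentation N := Classical.arbitrary _
    let S := ShortComplex.mk _ _ (cokernel.condition I.f)
    have hS : S.ShortExact := { exact := ShortComplex.exact_cokernel I.f }
    have hI : Injective S.X₂ := I.injective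
    have hFI : ∀ i, Injective (S.map (F i)).X₂ := fun i =>
      Functor.PreservesInjectiveObjects.injective_obj I.injective
    have hex : ∀ i, Function.Exact
        ((Ext.mk₀ (S.map (F i)).g).postcomp (Y i) (add_zero n))
        ((hS.map_of_exact (F i)).extClass.postcomp (Y i) (rfl : n + 1 = n + 1)) := fun i =>
      (ShortComplex.ab_exact_iff_function_exact _).1
        (Ext.covariant_sequence_exact₃' (Y i) (hS.map_of_exact (F i)) n (n + 1) rfl)
    refine AddMonoidHom.bijective_of_surjective_of_bijective_of_right_exact
      ((Ext.mk₀ S.g).postcomp X (add_zero n)) (hS.extClass.postcomp X (rfl : n + 1 = n + 1))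
      (AddMonoidHom.piMap fun i => (Ext.mk₀ (S.map (F i)).g).postcomp (Y i) (add_zero n))
      (AddMonoidHom.piMap fun i =>
        (hS.map_of_exact (F i)).extClass.postcomp (Y i) (rfl : n + 1 = n + 1))
      (AddMonoidHom.pi fun i => extPullback (F i) (u i) S.X₂ n)
      (AddMonoidHom.pi fun i => extPullback (F i) (u i) S.X₃ n) _ ?_ ?_
      ((ShortComplex.ab_exact_iff_function_exact _).1
        (Ext.covariant_sequence_exact₃' X hS n (n + 1) rfl)) ?_ (ih _).2 (ih _) ?_ ?_
    · ext e i
      change (extPullback (F i) (u i) S.X₂ n e).comp (Ext.mk₀ ((F i).map S.g)) (add_zero n) =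
        extPullback (F i) (u i) S.X₃ n (e.comp (Ext.mk₀ S.g) (add_zero n))
      rw [extPullback_comp, Ext.mapExactFunctor_mk₀]
    · ext e i
      change (extPullback (F i) (u i) S.X₃ n e).comp (hS.map_of_exact (F i)).extClass rfl =
        extPullback (F i) (u i) S.X₁ (n + 1) (e.comp hS.extClass rfl)
      rw [extPullback_comp, Ext.mapExactFunctor_extClass]
      rfl
    · intro y
      constructor
      · intro hy
        choose x hx using fun i => (hex i (y i)).1 (congrFun hy i)
        exact ⟨x, funext hx⟩
      · rintro ⟨x, rfl⟩
        exact funext fun i => (hex i _).2 ⟨x i, rfl⟩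
    · intro x
      exact Ext.covariant_sequence_exact₁ X hS x
        ((Ext.subsingleton_of_injective X S.X₂ n).elim _ _) rfl
    · intro y
      choose x hx using fun i => Ext.covariant_sequence_exact₁ (Y i) (hS.map_of_exact (F i)) (y i)
        ((Ext.subsingleton_of_injective (Y i) (S.map (F i)).X₂ n).elim _ _) rfl
      exact ⟨x, funext hx⟩

end AbstractExt

/-! ### Ext classes computed by projective resolutions -/

section Resolutions
open Limits Abelian Localization CochainComplex HomComplex
universe w w' v v' u₁ u₁'

variable {C : Type u₁} [Category.{v} C] [Abelian C] {D : Type u₁'} [Category.{v'} D] [Abelian D]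

local notation "Qis" => HomologicalComplex.quasiIso _ (ComplexShape.up ℤ)

variable {X : C} (R : ProjectiveResolution X)

theorem smallShiftedHom_mk₀_comp_mk {K : Type u₁} [Category.{v} K] [HasShift K ℤ]
    (V : MorphismProperty K) [V.IsCompatibleWithShift ℤ] {X Y Z : K}
    [HasSmallLocalizedShiftedHom.{w} V ℤ X Y] [HasSmallLocalizedShiftedHom.{w} V ℤ Y Z]
    [HasSmallLocalizedShiftedHom.{w} V ℤ X Z] [HasSmallLocalizedShiftedHom.{w} V ℤ Z Z] {n : ℤ}
    (f : X ⟶ Y) (g : ShiftedHom Y Z n) :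
    (SmallShiftedHom.mk₀ V (0 : ℤ) rfl f).comp (SmallShiftedHom.mk V g) (add_zero n) =
      SmallShiftedHom.mk V (f ≫ g : ShiftedHom X Z n) := by
  apply (SmallShiftedHom.equiv V V.Q).injective
  simp [SmallShiftedHom.equiv_comp, ShiftedHom.map, ShiftedHom.mk₀_comp]

theorem smallShiftedHom_mk₀_comp_mk₀ {K : Type u₁} [Category.{v} K] [HasShift K ℤ]
    (V : MorphismProperty K) [V.IsCompatibleWithShift ℤ] {X Y Z : K}
    [HasSmallLocalizedShiftedHom.{w} V ℤ X Y] [HasSmallLocalizedShiftedHom.{w} V ℤ Y Z]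
    [HasSmallLocalizedShiftedHom.{w} V ℤ X Z] [HasSmallLocalizedShiftedHom.{w} V ℤ Z Z]
    (f : X ⟶ Y) (g : Y ⟶ Z) :
    (SmallShiftedHom.mk₀ V (0 : ℤ) rfl f).comp (SmallShiftedHom.mk₀ V (0 : ℤ) rfl g) (add_zero 0) =
      SmallShiftedHom.mk₀ V (0 : ℤ) rfl (f ≫ g) := by
  apply (SmallShiftedHom.equiv V V.Q).injective
  simp [SmallShiftedHom.equiv_comp]

/-- The morphism of cochain complexes from the resolution to `Y⟦n⟧` attached to a cocycle. -/
def shiftedHomOfCocycle {Y : C} {n : ℕ} (f : R.complex.X n ⟶ Y) (m : ℕ) (hm : n + 1 = m)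
    (hf : R.complex.d m n ≫ f = 0) :
    ShiftedHom R.cochainComplex ((singleFunctor C 0).obj Y) (n : ℤ) :=
  Cocycle.equivHomShift.symm
    (Cocycle.toSingleMk ((R.cochainComplexXIso (-n) n rfl).hom ≫ f) (by simp)
      (-m) (by lia) (by simpa [R.cochainComplex_d _ _ m n rfl rfl]))

theorem equivHomShift_v {K : CochainComplex C ℤ} {Y : C} (n : ℕ)
    (g : K ⟶ ((singleFunctor C 0).obj Y)⟦(n : ℤ)⟧) :
    (Cocycle.equivHomShift g).1.v (-n) 0 (by simp) =
      g.f (-n) ≫ (((singleFunctor C 0).obj Y).shiftFunctorObjXIso n (-n) 0 (by simp)).hom := by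
  rw [Cocycle.equivHomShift_apply]
  refine (Cochain.rightUnshift_v _ _ (zero_add (n : ℤ)) _ _ _ _ (add_zero (-(n : ℤ)))).trans ?_
  exact congrArg (· ≫ _) (Cochain.ofHom_v g _)

/-- A morphism to a complex concentrated in degree `-n` is determined by its component there. -/
theorem toShiftedSingle_ext {K : CochainComplex C ℤ} {Y : C} (n : ℕ)
    {g g' : K ⟶ ((singleFunctor C 0).obj Y)⟦(n : ℤ)⟧}
    (h : g.f (-n) ≫ (((singleFunctor C 0).obj Y).shiftFunctorObjXIso n (-n) 0 (by simp)).hom =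
      g'.f (-n) ≫ (((singleFunctor C 0).obj Y).shiftFunctorObjXIso n (-n) 0 (by simp)).hom) :
    g = g' := by
  apply Cocycle.equivHomShift.injective
  ext : 1
  apply (Cochain.toSingleEquiv (p := -(n : ℤ)) (by simp)).injective
  rw [← equivHomShift_v, ← equivHomShift_v] at h
  exact congrArg (· ≫ (HomologicalComplex.singleObjXSelf (.up ℤ) 0 Y).hom) h

theorem shiftedHomOfCocycle_f {Y : C} {n : ℕ} (f : R.complex.X n ⟶ Y) (m : ℕ) (hm : n + 1 = m)
    (hf : R.complex.d m n ≫ f = 0) :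
    (shiftedHomOfCocycle R f m hm hf).f (-n) ≫
        (((singleFunctor C 0).obj Y).shiftFunctorObjXIso n (-n) 0 (by simp)).hom =
      (R.cochainComplexXIso (-n) n rfl).hom ≫ f ≫
        (HomologicalComplex.singleObjXSelf (.up ℤ) 0 Y).inv := by
  rw [← equivHomShift_v, shiftedHomOfCocycle, AddEquiv.apply_symm_apply]
  refine (Cochain.toSingleMk_v _ _).trans ?_
  rw [Category.assoc]

section
variable [HasExt.{w} C]

/-- The defining property of `extMk`: its pullback to the resolution is represented by the given
cocycle. -/
theorem mk₀_π'_comp_extMk {Y : C} {n : ℕ} (f : R.complex.X n ⟶ Y) (m : ℕ) (hm : n + 1 = m)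
    (hf : R.complex.d m n ≫ f = 0) :
    (SmallShiftedHom.mk₀ Qis (0 : ℤ) rfl R.π').comp (R.extMk f m hm hf) (add_zero _) =
      SmallShiftedHom.mk.{w} Qis (shiftedHomOfCocycle R f m hm hf) := by
  let e := SmallShiftedHom.precompEquiv.{w} (W := HomologicalComplex.quasiIso C (.up ℤ)) (M := ℤ)
    (Z := (singleFunctor C 0).obj Y) (a := (n : ℤ)) R.π'
      (by rw [HomologicalComplex.mem_quasiIso_iff]; infer_instance)
  exact e.apply_symm_apply _

theorem eq_extMk_of_mk₀_π'_comp {Y : C} {n : ℕ} (f : R.complex.X n ⟶ Y) (m : ℕ) (hm : n + 1 = m)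
    (hf : R.complex.d m n ≫ f = 0) (e : Ext X Y n)
    (he : (SmallShiftedHom.mk₀ Qis (0 : ℤ) rfl R.π').comp e (add_zero _) =
      SmallShiftedHom.mk.{w} Qis (shiftedHomOfCocycle R f m hm hf)) : e = R.extMk f m hm hf := by
  rw [← mk₀_π'_comp_extMk] at he
  exact (SmallShiftedHom.precompEquiv.{w} (W := HomologicalComplex.quasiIso C (.up ℤ)) (M := ℤ)
    (Z := (singleFunctor C 0).obj Y) (a := (n : ℤ)) R.π'
      (by rw [HomologicalComplex.mem_quasiIso_iff]; infer_instance)).injective he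

end

section
variable (F : C ⥤ D) {X' : D} (S : ProjectiveResolution X')
  (φ : ∀ n, S.complex.X n ⟶ F.obj (R.complex.X n))

/-- The extension by zero of a family of morphisms to nonpositive cochain degrees. -/
def extendToImageF (i : ℤ) : S.cochainComplex.X i ⟶ F.obj (R.cochainComplex.X i) :=
  if h : i ≤ 0 then
    (S.cochainComplexXIso i (-i).toNat (by lia)).hom ≫ φ (-i).toNat ≫
      F.map (R.cochainComplexXIso i (-i).toNat (by lia)).inv
  else 0

theorem extendToImageF_eq (i : ℤ) (n : ℕ) (h : -(n : ℤ) = i) :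
    extendToImageF R F S φ i = (S.cochainComplexXIso i n h).hom ≫ φ n ≫
      F.map (R.cochainComplexXIso i n h).inv := by
  obtain rfl : (-i).toNat = n := by lia
  exact dif_pos (by lia)

variable [F.Additive] {φ}

theorem extendToImageF_comm
    (hφ : ∀ n, φ (n + 1) ≫ F.map (R.complex.d (n + 1) n) = S.complex.d (n + 1) n ≫ φ n) (i : ℤ) :
    extendToImageF R F S φ i ≫ F.map (R.cochainComplex.d i (i + 1)) =
      S.cochainComplex.d i (i + 1) ≫ extendToImageF R F S φ (i + 1) := by
  by_cases hi : i + 1 ≤ 0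
  · obtain ⟨n, hn⟩ : ∃ n : ℕ, -(n : ℤ) = i + 1 := ⟨(-(i + 1)).toNat, by lia⟩
    have hn' : -((n + 1 : ℕ) : ℤ) = i := by lia
    rw [extendToImageF_eq R F S φ (i + 1) n hn, extendToImageF_eq R F S φ i (n + 1) hn',
      S.cochainComplex_d i (i + 1) (n + 1) n hn' hn, R.cochainComplex_d i (i + 1) (n + 1) n hn' hn]
    simp only [Category.assoc, ← F.map_comp, Iso.inv_hom_id_assoc]
    simp only [F.map_comp, reassoc_of% hφ]
  · have h0 : IsZero (F.obj (R.cochainComplex.X (i + 1))) :=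
      F.map_isZero (R.cochainComplex.isZero_of_isStrictlyLE 0 _ (by lia))
    exact h0.eq_of_tgt _ _

variable (hφ : ∀ n, φ (n + 1) ≫ F.map (R.complex.d (n + 1) n) = S.complex.d (n + 1) n ≫ φ n)

/-- The morphism from a resolution `S` to the image under `F` of a resolution `R`, both viewed as
cochain complexes, given by a compatible family of morphisms `φ`. -/
def extendToImage : S.cochainComplex ⟶ (F.mapHomologicalComplex (.up ℤ)).obj R.cochainComplex where
  f i := extendToImageF R F S φ i
  comm' i j hij := by
    obtain rfl : i + 1 = j := hij
    exact extendToImageF_comm R F S hφ i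

/-- If the family `φ` lifts `w`, then `extendToImage` covers `w` under the augmentations. -/
theorem extendToImage_comp_π' (w : X' ⟶ F.obj X)
    (hw : φ 0 ≫ F.map (R.π.f 0) = S.π.f 0 ≫ w) :
    extendToImage R F S hφ ≫ (F.mapHomologicalComplex (.up ℤ)).map R.π' ≫
      (F.mapCochainComplexSingleFunctor 0).hom.app X = S.π' ≫ (singleFunctor D 0).map w := by
  refine HomologicalComplex.to_single_hom_ext ?_
  have h1 : ((F.mapHomologicalComplex (.up ℤ)).map R.π').f 0 = F.map (R.π'.f 0) := rfl
  have h2 : ((F.mapCochainComplexSingleFunctor 0).hom.app X).f 0 =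
    F.map (HomologicalComplex.singleObjXSelf (.up ℤ) 0 X).hom ≫
      (HomologicalComplex.singleObjXSelf (.up ℤ) 0 (F.obj X)).inv :=
    HomologicalComplex.singleMapHomologicalComplex_hom_app_self F (.up ℤ) 0 X
  have h3 : ((singleFunctor D 0).map w).f 0 = (HomologicalComplex.singleObjXSelf (.up ℤ) 0 X').hom ≫
      w ≫ (HomologicalComplex.singleObjXSelf (.up ℤ) 0 (F.obj X)).inv :=
    HomologicalComplex.single_map_f_self (.up ℤ) 0 w
  have h4 : (extendToImage R F S hφ).f 0 = extendToImageF R F S φ 0 := rfl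
  have h7 : ∀ {A B : D} {A' Z Z' : C} (p : A ⟶ B) (q : B ⟶ F.obj A') (i : Z ≅ A') (x : A' ⟶ X)
      (j : Z' ≅ X) (y : F.obj X ⟶ ((singleFunctor D 0).obj (F.obj X)).X 0),
      (p ≫ q ≫ F.map i.inv) ≫ F.map (i.hom ≫ x ≫ j.inv) ≫ F.map j.hom ≫ y =
        p ≫ (q ≫ F.map x) ≫ y := by
    intro A B A' Z Z' p q i x j y
    simp only [Category.assoc, ← F.map_comp_assoc, Iso.inv_hom_id_assoc, Iso.inv_hom_id,
      Category.comp_id]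
  have h8 : ∀ {A B Z : D} (p : A ⟶ B) (x : B ⟶ X') (j : Z ≅ X')
      (y : F.obj X ⟶ ((singleFunctor D 0).obj (F.obj X)).X 0),
      (p ≫ x ≫ j.inv) ≫ j.hom ≫ w ≫ y = p ≫ (x ≫ w) ≫ y := by
    intro A B Z p x j y
    simp only [Category.assoc, Iso.inv_hom_id_assoc]
  rw [HomologicalComplex.comp_f, HomologicalComplex.comp_f, HomologicalComplex.comp_f, h1, h2, h3,
    h4, extendToImageF_eq R F S φ 0 0 rfl, R.π'_f_zero, S.π'_f_zero]
  refine (h7 _ _ _ _ (HomologicalComplex.singleObjXSelf (.up ℤ) 0 X) _).trans ?_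
  refine Eq.trans ?_ (h8 _ _ (HomologicalComplex.singleObjXSelf (.up ℤ) 0 X') _).symm
  exact congrArg (fun t => _ ≫ t ≫ _) hw

theorem extendToImage_comp_shiftedHom {Y : C} {n : ℕ} (f : R.complex.X n ⟶ Y) (m : ℕ)
    (hm : n + 1 = m) (hf : R.complex.d m n ≫ f = 0) (hf' : S.complex.d m n ≫ φ n ≫ F.map f = 0) :
    extendToImage R F S hφ ≫
      (((shiftedHomOfCocycle R f m hm hf).map (F.mapHomologicalComplex (.up ℤ))).comp
        (ShiftedHom.mk₀ (0 : ℤ) rfl ((F.mapCochainComplexSingleFunctor 0).hom.app Y))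
        (zero_add _)) =
      shiftedHomOfCocycle S (φ n ≫ F.map f) m hm hf' := by
  rw [ShiftedHom.comp_mk₀, ShiftedHom.map]
  apply toShiftedSingle_ext
  rw [shiftedHomOfCocycle_f]
  have h1 := congrArg F.map (shiftedHomOfCocycle_f R f m hm hf)
  have h4 : (extendToImage R F S hφ).f (-n) = extendToImageF R F S φ (-n) := rfl
  have h5 : (((F.mapHomologicalComplex (.up ℤ)).commShiftIso (n : ℤ)).hom.app
      ((singleFunctor C 0).obj Y)).f (-n) ≫
      (((F.mapCochainComplexSingleFunctor 0).hom.app Y)⟦(n : ℤ)⟧').f (-n) ≫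
      (((singleFunctor D 0).obj (F.obj Y)).shiftFunctorObjXIso n (-n) 0 (by simp)).hom =
      F.map (((singleFunctor C 0).obj Y).shiftFunctorObjXIso n (-n) 0 (by simp)).hom ≫
        ((F.mapCochainComplexSingleFunctor 0).hom.app Y).f 0 := by
    rw [Functor.mapHomologicalComplex_commShiftIso_hom_app_f]
    refine (Category.id_comp _).trans ?_
    have h6 := HomologicalComplex.XIsoOfEq_hom_naturality
      ((F.mapCochainComplexSingleFunctor 0).hom.app Y) (neg_add_cancel (n : ℤ))
    refine h6.trans (congrArg (· ≫ _) ?_)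
    exact (eqToHom_map F (by simp)).symm
  have h2 : ((F.mapCochainComplexSingleFunctor 0).hom.app Y).f 0 =
    F.map (HomologicalComplex.singleObjXSelf (.up ℤ) 0 Y).hom ≫
      (HomologicalComplex.singleObjXSelf (.up ℤ) 0 (F.obj Y)).inv :=
    HomologicalComplex.singleMapHomologicalComplex_hom_app_self F (.up ℤ) 0 Y
  have h3 : ∀ {A B₁ B₂ B₃ B₄ B₅ B₆ : D} (p : A ⟶ B₁) (c : B₁ ⟶ B₂) (q : B₂ ⟶ B₃) (r : B₃ ⟶ B₄)
      (t : B₄ ⟶ B₅) (x : B₂ ⟶ B₆) (y : B₆ ⟶ B₅) (c' : B₁ ⟶ B₆), q ≫ r ≫ t = x ≫ y → c ≫ x = c' →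
      (p ≫ (c ≫ q) ≫ r) ≫ t = p ≫ c' ≫ y := by
    rintro A B₁ B₂ B₃ B₄ B₅ B₆ p c q r t x y c' h rfl
    simp only [Category.assoc, h]
  rw [F.map_comp] at h1
  refine (h3 _ _ _ _ _ _ _ _ h5 h1).trans ?_
  rw [h4, extendToImageF_eq R F S φ (-n) n rfl, h2]
  have h7 : ∀ {A B : D} {A' Z Z' : C} (p : A ⟶ B) (q : B ⟶ F.obj A') (i : Z ≅ A') (x : A' ⟶ Y)
      (j : Z' ≅ Y) (y : F.obj Y ⟶ ((singleFunctor D 0).obj (F.obj Y)).X 0),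
      (p ≫ q ≫ F.map i.inv) ≫ F.map (i.hom ≫ x ≫ j.inv) ≫ F.map j.hom ≫ y =
        p ≫ (q ≫ F.map x) ≫ y := by
    intro A B A' Z Z' p q i x j y
    simp only [Category.assoc, ← F.map_comp_assoc, Iso.inv_hom_id_assoc, Iso.inv_hom_id,
      Category.comp_id]
  exact h7 _ _ _ _ (HomologicalComplex.singleObjXSelf (.up ℤ) 0 Y) _

variable [PreservesFiniteLimits F] [PreservesFiniteColimits F] [HasExt.{w} C] [HasExt.{w'} D]

/-- Exact functors send the class of a cocycle on a resolution `R` to the class of its image, in the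
sense that pulling back the latter to a resolution `S` mapping to the image of `R` represents the
class by the cocycle pulled back to `S`. -/
theorem mk₀_comp_mapExactFunctor_extMk
    (hφ : ∀ n, φ (n + 1) ≫ F.map (R.complex.d (n + 1) n) = S.complex.d (n + 1) n ≫ φ n)
    (w : X' ⟶ F.obj X)
    (hw : φ 0 ≫ F.map (R.π.f 0) = S.π.f 0 ≫ w) {Y : C} {n : ℕ} (f : R.complex.X n ⟶ Y) (m : ℕ)
    (hm : n + 1 = m) (hf : R.complex.d m n ≫ f = 0)
    (hf' : S.complex.d m n ≫ φ n ≫ F.map f = 0) :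
    (Ext.mk₀ w).comp ((R.extMk f m hm hf).mapExactFunctor F) (zero_add n) =
      S.extMk (φ n ≫ F.map f) m hm hf' := by
  let FR := (F.mapHomologicalComplex (.up ℤ)).obj R.cochainComplex
  let p : FR ⟶ (singleFunctor D 0).obj (F.obj X) :=
    (F.mapHomologicalComplex (.up ℤ)).map R.π' ≫ (F.mapCochainComplexSingleFunctor 0).hom.app X
  have hp : HomologicalComplex.quasiIso D (.up ℤ) p := by
    rw [HomologicalComplex.mem_quasiIso_iff]
    infer_instance
  have hS : HomologicalComplex.quasiIso D (.up ℤ) S.π' := by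
    rw [HomologicalComplex.mem_quasiIso_iff]
    infer_instance
  have i1 : ∀ Z : D, HasSmallLocalizedShiftedHom.{w'} (HomologicalComplex.quasiIso D (.up ℤ)) ℤ
      FR ((singleFunctor D 0).obj Z) := fun Z =>
    (hasSmallLocalizedShiftedHom_iff_source _ ℤ p hp _).2 inferInstance
  have i1' : ∀ Z : C, HasSmallLocalizedShiftedHom.{w'} (HomologicalComplex.quasiIso D (.up ℤ)) ℤ
      FR ((F ⋙ singleFunctor D 0).obj Z) := fun Z => i1 _
  have i2 : HasSmallLocalizedShiftedHom.{w'} (HomologicalComplex.quasiIso D (.up ℤ)) ℤ FR FR :=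
    (hasSmallLocalizedShiftedHom_iff_target _ ℤ _ p hp).2 (i1 _)
  have i3 : HasSmallLocalizedShiftedHom.{w'} (HomologicalComplex.quasiIso D (.up ℤ)) ℤ
      S.cochainComplex FR :=
    (hasSmallLocalizedShiftedHom_iff_target _ ℤ _ p hp).2 inferInstance
  let Φ := F.mapHomologicalComplexUpToQuasiIsoLocalizerMorphism (.up ℤ)
  let V := HomologicalComplex.quasiIso D (.up ℤ)
  let sX := (F.mapCochainComplexSingleFunctor 0).app X
  let sY := (F.mapCochainComplexSingleFunctor 0).app Y
  let e : Ext (F.obj X) (F.obj Y) n := (R.extMk f m hm hf).mapExactFunctor F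
  let c : ShiftedHom FR ((singleFunctor D 0).obj (F.obj Y)) (n : ℤ) :=
    ((shiftedHomOfCocycle R f m hm hf).map (F.mapHomologicalComplex (.up ℤ))).comp
      (ShiftedHom.mk₀ (0 : ℤ) rfl sY.hom) (zero_add _)
  -- apply `F` to the defining property of `extMk`
  have h0 : (SmallShiftedHom.mk₀ V (0 : ℤ) rfl p).comp e (add_zero _) =
      SmallShiftedHom.mk.{w'} V c := by
    have h1 := congrArg (Φ.smallShiftedHomMap (Iso.refl FR) sY) (mk₀_π'_comp_extMk R f m hm hf)
    have h2 := Φ.smallShiftedHomMap_comp (Iso.refl FR) sX sY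
      (SmallShiftedHom.mk₀.{w} Qis (0 : ℤ) rfl R.π') (R.extMk f m hm hf) (add_zero (n : ℤ))
    have h3 := Φ.smallShiftedHomMap_mk₀ (Iso.refl FR) sX (0 : ℤ) rfl R.π'
    have h4 := Φ.smallShiftedHomMap_mk (Iso.refl FR) sY (shiftedHomOfCocycle R f m hm hf)
    rw [h3, h1, h4] at h2
    have h5 : (Iso.refl FR).inv ≫ Φ.functor.map R.π' ≫ sX.hom = p := Category.id_comp _
    have h6 : (ShiftedHom.mk₀ (0 : ℤ) rfl (Iso.refl FR).inv).comp
        (((shiftedHomOfCocycle R f m hm hf).map Φ.functor).comp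
          (ShiftedHom.mk₀ (0 : ℤ) rfl sY.hom) (zero_add _)) (add_zero _) = c :=
      ShiftedHom.mk₀_id_comp _ _ _
    exact ((congrArg (fun q => (SmallShiftedHom.mk₀ V (0 : ℤ) rfl q).comp e (add_zero _))
      h5).symm.trans h2.symm).trans (congrArg (SmallShiftedHom.mk V) h6)
  apply eq_extMk_of_mk₀_π'_comp
  rw [← extendToImage_comp_shiftedHom R F S hφ f m hm hf hf']
  refine Eq.trans ?_ (smallShiftedHom_mk₀_comp_mk V (extendToImage R F S hφ) c)
  rw [← h0]
  have h7 := smallShiftedHom_mk₀_comp_mk₀.{w'} V (extendToImage R F S hφ) p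
  have h8 := smallShiftedHom_mk₀_comp_mk₀.{w'} V S.π' ((singleFunctor D 0).map w)
  have h9 : extendToImage R F S hφ ≫ p = S.π' ≫ (singleFunctor D 0).map w :=
    extendToImage_comp_π' R F S hφ w hw
  refine (SmallShiftedHom.comp_assoc V (SmallShiftedHom.mk₀ V (0 : ℤ) rfl S.π')
    (SmallShiftedHom.mk₀ V (0 : ℤ) rfl ((singleFunctor D 0).map w)) e (add_zero 0) (add_zero _)
    (by lia)).symm.trans ?_
  refine Eq.trans ?_ (SmallShiftedHom.comp_assoc V
    (SmallShiftedHom.mk₀ V (0 : ℤ) rfl (extendToImage R F S hφ))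
    (SmallShiftedHom.mk₀ V (0 : ℤ) rfl p) e (add_zero 0) (add_zero _) (by lia))
  rw [h7, h8, h9]

end

end Resolutions

/-! ### Functoriality of group cohomology in terms of Ext -/

section GroupCohomology
open Abelian
variable {k G K : Type u} [CommRing k] [Group G] [Group K]

/-- The generator of the `n`-th term of the bar resolution indexed by an `n`-tuple. -/
def barGen (k G : Type u) [CommRing k] [Group G] (n : ℕ) (x : Fin n → G) :
    (Rep.barResolution k G).complex.X n :=
  Finsupp.single x (MonoidAlgebra.single 1 1)

theorem barHom_barGen (M : Rep.{u} k G) (n : ℕ) (f : (Fin n → G) → M) (x : Fin n → G) :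
    (barHom M n f).hom (barGen k G n x) = f x :=
  congrFun ((Rep.freeLiftLEquiv k G (Fin n → G) M).apply_symm_apply f) x

theorem bar_ext {M : Rep.{u} k G} {n : ℕ} {p q : (Rep.barResolution k G).complex.X n ⟶ M}
    (h : ∀ x, p.hom (barGen k G n x) = q.hom (barGen k G n x)) : p = q :=
  Rep.free_ext k G _ p q h

theorem barHom_comp {M N : Rep.{u} k G} (n : ℕ) (f : (Fin n → G) → M) (p : M ⟶ N) :
    barHom M n f ≫ p = barHom N n (fun x => p.hom (f x)) := by
  refine bar_ext fun x => ?_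
  rw [barHom_barGen]
  exact congrArg p.hom (barHom_barGen M n f x)

theorem barHom_gen (n : ℕ) : barHom _ n (barGen k G n) = 𝟙 _ :=
  bar_ext fun x => barHom_barGen _ _ _ x

variable (k) in
/-- The comparison map from the bar resolution of `K` to the restriction along `γ : K → G` of the
bar resolution of `G`. -/
def barMap (γ : K →* G) (n : ℕ) : (Rep.barResolution k K).complex.X n ⟶
    (Rep.resFunctor γ).obj ((Rep.barResolution k G).complex.X n) :=
  barHom _ n fun x => barGen k G n (γ ∘ x)

theorem barMap_comp (γ : K →* G) {M : Rep.{u} k G} (n : ℕ) (f : (Fin n → G) → M) :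
    barMap k γ n ≫ (Rep.resFunctor γ).map (barHom M n f) =
      barHom ((Rep.resFunctor γ).obj M) n (fun x => f (γ ∘ x)) :=
  (barHom_comp n _ _).trans (congrArg _ (funext fun x => barHom_barGen M n f (γ ∘ x)))

/-- The comparison maps commute with the differentials: both composites are obtained from the
tautological cochain with values in the bar resolution, whose restriction along `γ` commutes with
the differential of inhomogeneous cochains. -/
theorem barMap_d (γ : K →* G) (n : ℕ) :
    barMap k γ (n + 1) ≫ (Rep.resFunctor γ).map ((Rep.barResolution k G).complex.d (n + 1) n) =
      (Rep.barResolution k K).complex.d (n + 1) n ≫ barMap k γ n := by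
  have h1 := d_barHom _ n (barGen k G n)
  rw [barHom_gen, Category.comp_id] at h1
  rw [h1, barMap_comp, barMap, d_barHom]
  have h2 := (groupCohomology.cochainsMap γ
    (𝟙 ((Rep.resFunctor γ).obj ((Rep.barResolution k G).complex.X n)))).comm n (n + 1)
  exact congrArg (barHom _ (n + 1)) (congrArg (fun φ => φ.hom (barGen k G n)) h2).symm

variable (k) in
/-- The identity of `k`, as a morphism from the trivial module to the restriction of the trivial
module. -/
def trivialRes (γ : K →* G) (A : Type u) [AddCommGroup A] [Module k A] :
    Rep.trivial k K A ⟶ (Rep.resFunctor γ).obj (Rep.trivial k G A) :=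
  Rep.ofHom ⟨LinearMap.id, fun _ => rfl⟩

/-- The isomorphism between the terms of the bar resolution and of the standard resolution maps the
`k`-basis of the former to the `k`-basis of the latter. -/
theorem exists_diagonalSuccIsoFree_inv_single (m : ℕ) (f : Fin m → G) (g : G) (r : k) :
    ∃ y, (Rep.diagonalSuccIsoFree k G m).inv.hom (Finsupp.single f (MonoidAlgebra.single g r)) =
      MonoidAlgebra.single y r := by
  simp only [Rep.diagonalSuccIsoFree, Rep.diagonalSuccIsoTensorTrivial, Iso.trans_inv, Rep.hom_comp,
    Representation.IntertwiningMap.comp_apply]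
  have step1 : (Rep.Hom.hom (Rep.leftRegularTensorTrivialIsoFree k G (Fin m → G)).inv)
      (Finsupp.single f (.single g r)) = TensorProduct.tmul k (.single g 1) (.single f r) :=
    Representation.leftRegularTensorTrivialIsoFree_symm_apply_single_single f g r
  rw [step1]
  have key₁ := Representation.linearizeMap_single (k := k)
    (Action.diagonalSuccIsoTensorTrivial G m).inv (g, f) ((1 : k) * r)
  have key₂ := Representation.LinearizeMonoidal.μ_apply_single_single (k := k)
    (X := Action.leftRegular G) (Y := Action.trivial G (Fin m → G)) g f 1 r
  exact ⟨_, ((congrArg (fun z => (Representation.linearizeMap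
    (Action.diagonalSuccIsoTensorTrivial G m).inv) z) key₂).trans key₁).trans (by rw [one_mul])⟩

/-- The augmentation of the bar resolution maps its generator in degree `0` to `1`. -/
theorem barResolution_π_gen (x : Fin 0 → G) :
    ((Rep.barResolution k G).π.f 0).hom (barGen k G 0 x) = (1 : k) := by
  have h0 : (Rep.standardComplex.εToSingle₀ k G).f 0 = Rep.standardComplex.ε k G :=
    ChainComplex.toSingle₀Equiv_symm_apply_f_zero _ _
  have h1 : (Rep.barResolution k G).π.f 0 =
      (Rep.diagonalSuccIsoFree k G 0).inv ≫ (Rep.standardComplex.ε k G) :=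
    congrArg ((Rep.diagonalSuccIsoFree k G 0).inv ≫ ·) h0
  have h2 : ∀ y, (Rep.standardComplex.ε k G).hom (MonoidAlgebra.single y 1) = (1 : k) := fun y => by
    simp [Rep.standardComplex.ε]
  obtain ⟨y, hy⟩ := exists_diagonalSuccIsoFree_inv_single (k := k) 0 x 1 1
  rw [h1]
  exact (congrArg (Rep.standardComplex.ε k G).hom hy).trans (h2 y)

theorem barMap_π (γ : K →* G) :
    barMap k γ 0 ≫ (Rep.resFunctor γ).map ((Rep.barResolution k G).π.f 0) =
      (Rep.barResolution k K).π.f 0 ≫ trivialRes k γ k := by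
  refine (barHom_comp 0 _ _).trans (bar_ext fun x => ?_)
  rw [barHom_barGen]
  exact (barResolution_π_gen (γ ∘ x)).trans (barResolution_π_gen x).symm

/-- Restriction in group cohomology corresponds to restriction of extension classes. -/
theorem groupCohomologyAddEquivExt_map (γ : K →* G) (M : Rep.{u} k G) (n : ℕ)
    (x : groupCohomology M n) :
    groupCohomologyAddEquivExt ((Rep.resFunctor γ).obj M) n
        (groupCohomology.map γ (𝟙 ((Rep.resFunctor γ).obj M)) n x) =
      extPullback (Rep.resFunctor γ) (trivialRes k γ k) M n (groupCohomologyAddEquivExt M n x) := by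
  obtain ⟨z, rfl⟩ := piHom_surjective M n x
  have h1 : groupCohomology.map γ (𝟙 ((Rep.resFunctor γ).obj M)) n (piHom M n z) =
      groupCohomology.π ((Rep.resFunctor γ).obj M) n
        (groupCohomology.cocyclesMap γ (𝟙 ((Rep.resFunctor γ).obj M)) n z) :=
    congrArg (fun φ => φ.hom z) (groupCohomology.π_map γ (𝟙 ((Rep.resFunctor γ).obj M)) n)
  have h2 : groupCohomologyAddEquivExt M n (piHom M n z) = extOfCocycle M n z :=
    groupCohomologyAddEquivExt_pi M n z
  have h3 : iCocyclesHom ((Rep.resFunctor γ).obj M) n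
      (groupCohomology.cocyclesMap γ (𝟙 ((Rep.resFunctor γ).obj M)) n z) =
      fun x => iCocyclesHom M n z (γ ∘ x) :=
    congrArg (fun φ => φ.hom z) (HomologicalComplex.cyclesMap_i
      (groupCohomology.cochainsMap γ (𝟙 ((Rep.resFunctor γ).obj M))) n)
  have h4 : barMap k γ n ≫ (Rep.resFunctor γ).map (barHom M n (iCocyclesHom M n z)) =
      barHom ((Rep.resFunctor γ).obj M) n (iCocyclesHom ((Rep.resFunctor γ).obj M) n
        (groupCohomology.cocyclesMap γ (𝟙 ((Rep.resFunctor γ).obj M)) n z)) := by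
    rw [barMap_comp, h3]
  have h5 := (d_barHom_eq_zero_iff ((Rep.resFunctor γ).obj M) n _).2 (d_iCocycles _ n
    (groupCohomology.cocyclesMap γ (𝟙 ((Rep.resFunctor γ).obj M)) n z))
  have h6 := mk₀_comp_mapExactFunctor_extMk (Rep.barResolution k G) (Rep.resFunctor γ)
    (Rep.barResolution k K) (barMap_d γ) (trivialRes k γ k) (barMap_π γ)
    (barHom M n (iCocyclesHom M n z)) (n + 1) rfl
    ((d_barHom_eq_zero_iff M n _).2 (d_iCocycles M n z)) (by rw [h4]; exact h5)
  rw [h1, h2, groupCohomologyAddEquivExt_pi, extPullback_apply]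
  refine Eq.trans ?_ h6.symm
  simp only [extOfCocycle, AddMonoidHom.coe_mk, ZeroHom.coe_mk, h4]

end GroupCohomology

/-! ### Injective representations and restriction -/

section Injectives
open Representation
variable {k G H : Type u} [CommRing k] [Group G] [Group H]

/-- `Rep k G` is equivalent to the category of `k[G]`-modules. -/
instance repEnoughInjectives (k G : Type u) [CommRing k] [Group G] :
    EnoughInjectives (Rep.{u} k G) :=
  EnoughInjectives.of_equivalence (Rep.equivalenceModuleMonoidAlgebra (k := k) (G := G)).functor

/-- A choice of representatives `r x` of the cosets `φ(H) x`, with the elements `d x` of `H` moving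
`x` to its representative. -/
theorem exists_rightCoset_section (φ : H →* G) (hφ : Function.Injective φ) :
    ∃ (r : G → G) (d : G → H), (∀ x, φ (d x) * x = r x) ∧ (∀ c x, r (φ c * x) = r x) ∧
      ∀ c x, d (φ c * x) * c = d x := by
  let R := QuotientGroup.rightRel φ.range
  let r : G → G := fun x => (Quotient.mk R x).out
  have h1 : ∀ x, ∃ c, φ c * x = r x := fun x => by
    have h : R (r x) x := Quotient.exact (Quotient.out_eq (Quotient.mk R x))
    obtain ⟨c, hc⟩ := QuotientGroup.rightRel_apply.1 h
    exact ⟨c⁻¹, by rw [map_inv, hc]; group⟩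
  choose d hd using h1
  have h2 : ∀ c x, r (φ c * x) = r x := fun c x =>
    congrArg Quotient.out (Quotient.sound (show R (φ c * x) x from
      QuotientGroup.rightRel_apply.2 ⟨c⁻¹, by rw [map_inv]; group⟩))
  refine ⟨r, d, hd, h2, fun c x => hφ (mul_right_cancel (b := x) ?_)⟩
  rw [map_mul, mul_assoc, hd, h2, hd]

/-- Induction along an injective homomorphism preserves injections: as a `k`-module, the module
induced from `M` is naturally embedded in the direct sum of copies of `M`. -/
theorem indMap_injective (φ : H →* G) (hφ : Function.Injective φ) {M N : Rep.{u} k H} (f : M ⟶ N)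
    (hf : Function.Injective f.hom) : Function.Injective (Rep.indMap φ f).hom := by
  obtain ⟨r, d, h1, h2, h3⟩ := exists_rightCoset_section φ hφ
  -- the embedding `x ⊗ m = r x ⊗ d x • m ↦ (r x, d x • m)`, whose left inverse is `S`
  let P (M : Rep.{u} k H) : IndV φ M.ρ →ₗ[k] (G →₀ M) :=
    Coinvariants.lift _ (TensorProduct.lift ((Finsupp.lift _ _ _ fun x =>
      Finsupp.lsingle (r x) ∘ₗ M.ρ (d x)) ∘ₗ (MonoidAlgebra.coeffLinearEquiv k).toLinearMap))
      (fun c => by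
        ext x m : 4
        simp [h2, ← Module.End.mul_apply, ← map_mul, h3])
  have hP : ∀ M x m, P M (IndV.mk φ M.ρ x m) = Finsupp.single (r x) (M.ρ (d x) m) := fun M x m => by
    simp [P]
  let S : (G →₀ M) →ₗ[k] IndV φ M.ρ := Finsupp.lsum k fun x => IndV.mk φ M.ρ x
  have hS : S ∘ₗ P M = LinearMap.id := by
    refine IndV.hom_ext _ _ fun x => LinearMap.ext fun m => ?_
    change S (P M (IndV.mk φ M.ρ x m)) = IndV.mk φ M.ρ x m
    rw [hP, ← h1]
    refine (Finsupp.lsum_single _ _ _ _).trans ?_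
    have := Coinvariants.mk_self_apply (tprod ((leftRegular k G).comp φ) M.ρ) (d x)
      (TensorProduct.tmul k (.single x 1) m)
    simpa using this
  have hN : P N ∘ₗ (Rep.indMap φ f).hom.toLinearMap =
      Finsupp.mapRange.linearMap f.hom.toLinearMap ∘ₗ P M := by
    refine IndV.hom_ext _ _ fun x => LinearMap.ext fun m => ?_
    change P N (IndV.mk φ N.ρ x (f.hom m)) =
      Finsupp.mapRange.linearMap f.hom.toLinearMap (P M (IndV.mk φ M.ρ x m))
    rw [hP, hP]
    simp [Rep.hom_comm_apply]
  have h4 : Function.Injective (P M) :=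
    Function.LeftInverse.injective (g := S) fun x => LinearMap.congr_fun hS x
  have h5 : Function.Injective (P N ∘ₗ (Rep.indMap φ f).hom.toLinearMap) := by
    rw [hN]
    exact (Finsupp.mapRange_injective _ (map_zero _) hf).comp h4
  exact Function.Injective.of_comp h5

/-- Restriction to a subgroup preserves injectives, since its left adjoint is exact. -/
theorem resFunctor_preservesInjectiveObjects (φ : H →* G) (hφ : Function.Injective φ) :
    (Rep.resFunctor (k := k) φ : Rep.{u} k G ⥤ Rep.{u} k H).PreservesInjectiveObjects := by
  have : (Rep.indFunctor.{u} k φ).PreservesMonomorphisms :=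
    ⟨fun f hf => (Rep.mono_iff_injective _).2
      (indMap_injective φ hφ f ((Rep.mono_iff_injective f).1 hf))⟩
  exact Functor.preservesInjectiveObjects_of_adjunction_of_preservesMonomorphisms
    (Rep.indResAdjunction.{u} k φ)

end Injectives

/-! ### The module `k[G] ⊗ I_G^{⊗ s}` as a sum of induced modules -/

section Basis
open MonoidalCategory
variable {k G : Type u} [CommRing k] [Group G] {P : Type*} [AddCommGroup P] [Module k P]

theorem subOne_one : subOne k (1 : G) = 0 :=
  Subtype.ext (sub_self _)

variable (k G) in
/-- The `k`-linear projection `k[G] → I_G`, `g ↦ g - 1`. -/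
def toAugIdeal : MonoidAlgebra k (TwoSided G) →ₗ[k] augIdeal k G :=
  (Finsupp.linearCombination k fun x : TwoSided G => subOne k x.val) ∘ₗ
    (MonoidAlgebra.coeffLinearEquiv k).toLinearMap

theorem toAugIdeal_single (x : TwoSided G) :
    toAugIdeal k G (MonoidAlgebra.single x 1) = subOne k x.val := by
  simp [toAugIdeal]

theorem toAugIdeal_apply (x : augIdeal k G) : toAugIdeal k G x.1 = x := by
  have h : (LinearMap.ker (augmentation k G)).subtype ∘ₗ toAugIdeal k G = LinearMap.id -
      (LinearMap.toSpanSingleton k _ (MonoidAlgebra.single (⟨1⟩ : TwoSided G) (1 : k))) ∘ₗ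
        augmentation k G := by
    refine MonoidAlgebra.lhom_ext' fun x => LinearMap.ext_ring ?_
    change (toAugIdeal k G (MonoidAlgebra.single x 1)).1 = MonoidAlgebra.single x 1 -
      augmentation k G (MonoidAlgebra.single x 1) • _
    rw [toAugIdeal_single, augmentation_single, one_smul]
    rfl
  refine Subtype.ext ((LinearMap.congr_fun h x.1).trans ?_)
  change x.1 - augmentation k G x.1 • _ = x.1
  rw [LinearMap.mem_ker.1 x.2, zero_smul, sub_zero]

theorem augIdeal_linearMap_ext {f f' : augIdeal k G →ₗ[k] P}
    (h : ∀ g : NontrivialElt G, f (subOne k g.val) = f' (subOne k g.val)) : f = f' := by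
  have h1 : f ∘ₗ toAugIdeal k G = f' ∘ₗ toAugIdeal k G := by
    refine MonoidAlgebra.lhom_ext' fun x => LinearMap.ext_ring ?_
    change f (toAugIdeal k G (MonoidAlgebra.single x 1)) =
      f' (toAugIdeal k G (MonoidAlgebra.single x 1))
    rw [toAugIdeal_single]
    by_cases hx : x.val = 1
    · rw [hx, subOne_one, map_zero, map_zero]
    · exact h ⟨x.val, hx⟩
  refine LinearMap.ext fun x => ?_
  rw [← toAugIdeal_apply x]
  exact LinearMap.congr_fun h1 x.1

theorem exists_augIdeal_linearMap (v : NontrivialElt G → P) :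
    ∃ f : augIdeal k G →ₗ[k] P, ∀ g, f (subOne k g.val) = v g := by
  classical
  let V : TwoSided G → P := fun x => if h : x.val = 1 then 0 else v ⟨x.val, h⟩
  let F : MonoidAlgebra k (TwoSided G) →ₗ[k] P :=
    Finsupp.linearCombination k V ∘ₗ (MonoidAlgebra.coeffLinearEquiv k).toLinearMap
  have hF : ∀ x, F (MonoidAlgebra.single x 1) = V x := fun x => by simp [F]
  refine ⟨F ∘ₗ (LinearMap.ker (augmentation k G)).subtype, fun g => ?_⟩
  change F (MonoidAlgebra.single ⟨g.val⟩ 1 - MonoidAlgebra.single ⟨1⟩ 1) = v g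
  rw [map_sub, hF, hF]
  simp [V, g.ne_one]

/-- Linear maps out of `I_G^{⊗ s}` are determined by their values on the tensors
`(t₁ - 1) ⊗ ⋯ ⊗ (t_s - 1)` with all `t_i ≠ 1`. -/
theorem augPow_linearMap_ext : ∀ {s : ℕ} {f f' : augPow k G s →ₗ[k] P},
    (∀ t : Tuple G s, f (basisTensor k s fun i => (t i).val) =
      f' (basisTensor k s fun i => (t i).val)) → f = f'
  | 0, _, _, h => LinearMap.ext_ring (h Fin.elim0)
  | s + 1, f, f', h => by
    refine TensorProduct.ext (M := augIdeal k G) (N := augPow k G s) ?_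
    refine augIdeal_linearMap_ext fun g => augPow_linearMap_ext fun t => ?_
    exact h (Fin.cons g t)

/-- Linear maps out of `I_G^{⊗ s}` may be prescribed on the tensors `(t₁ - 1) ⊗ ⋯ ⊗ (t_s - 1)` with
all `t_i ≠ 1`. -/
theorem exists_augPow_linearMap : ∀ {s : ℕ} (v : Tuple G s → P),
    ∃ f : augPow k G s →ₗ[k] P, ∀ t, f (basisTensor k s fun i => (t i).val) = v t
  | 0, v => ⟨LinearMap.toSpanSingleton k P (v Fin.elim0), fun t => by
      rw [Subsingleton.elim t Fin.elim0]
      exact one_smul k _⟩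
  | s + 1, v => by
    choose F hF using fun g : NontrivialElt G =>
      exists_augPow_linearMap fun t : Tuple G s => v (Fin.cons g t)
    obtain ⟨f, hf⟩ := exists_augIdeal_linearMap (k := k) F
    refine ⟨TensorProduct.lift (M := augIdeal k G) (N := augPow k G s) f, fun t => ?_⟩
    have h1 := hF (t 0) (Fin.tail t)
    rw [← hf, Fin.cons_self_tail] at h1
    exact h1

theorem basisTensor_eq_zero : ∀ {s : ℕ} (t : Fin s → G) (i : Fin s), t i = 1 →
    basisTensor k s t = 0
  | s + 1, t, i, h => by
    change TensorProduct.tmul k (subOne k (t 0)) (basisTensor k s (Fin.tail t)) =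
      (0 : TensorProduct k (augIdeal k G) (augPow k G s))
    induction i using Fin.cases with
    | zero => rw [h, subOne_one, TensorProduct.zero_tmul]
    | succ i => rw [basisTensor_eq_zero (Fin.tail t) i h, TensorProduct.tmul_zero]

end Basis

section UniversalProperty
open MonoidalCategory
variable {k G K : Type u} [CommRing k] [Group G] [Group K] {s : ℕ}

variable (k) in
/-- The element `1 ⊗ (t₁ - 1) ⊗ ⋯ ⊗ (t_s - 1)` of `k[G] ⊗ I_G^{⊗ s}`. -/
def middleElt (t : Fin s → G) : middleModule k G s :=
  TensorProduct.tmul k (MonoidAlgebra.single (⟨1⟩ : TwoSided G) (1 : k)) (basisTensor k s t)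

theorem middleModule_ρ_tmul (p : G × G) (x : twoSidedRep k G) (m : augPow k G s) :
    (middleModule k G s).ρ p (TensorProduct.tmul k x m) =
      TensorProduct.tmul k ((twoSidedRep k G).ρ p x) ((augPow k G s).ρ p m) := rfl

theorem twoSidedRep_ρ_single (p : G × G) (x : TwoSided G) (r : k) :
    (twoSidedRep k G).ρ p (MonoidAlgebra.single x r) = MonoidAlgebra.single (p • x) r := by
  simp

theorem middleElt_smul (g : G) (t : Fin s → G) :
    (middleModule k G s).ρ (g, g) (middleElt k t) = middleElt k fun i => g * t i * g⁻¹ := by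
  refine (middleModule_ρ_tmul _ _ _).trans ?_
  rw [twoSidedRep_ρ_single, basisTensor_smul, TwoSided.smul_def]
  simp only [mul_one, mul_inv_cancel]
  rfl

variable (k) in
/-- The `K`-morphism `k → k[G] ⊗ I_G^{⊗ s}`, `1 ↦ 1 ⊗ (t₁ - 1) ⊗ ⋯ ⊗ (t_s - 1)`, when `K` maps to
the centralizer of the tuple `t`, where `K` acts on the target through the diagonal of `G²`. -/
def middleUnit (γ : K →* G) (t : Fin s → G) (h : ∀ c i, γ c * t i * (γ c)⁻¹ = t i) :
    Rep.trivial k K k ⟶ (Rep.resFunctor ((diag G).comp γ)).obj (middleModule k G s) :=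
  Rep.ofHom ⟨LinearMap.toSpanSingleton k (middleModule k G s) (middleElt k t), fun c => by
    refine LinearMap.ext_ring ?_
    change (1 : k) • middleElt k t = (middleModule k G s).ρ (γ c, γ c) ((1 : k) • middleElt k t)
    rw [one_smul, middleElt_smul, funext (h c)]⟩

theorem middleUnit_apply (γ : K →* G) (t : Fin s → G) (h : ∀ c i, γ c * t i * (γ c)⁻¹ = t i)
    (x : k) : (middleUnit k γ t h).hom x = x • middleElt k t := rfl

theorem middleModule_hom_ext {N : Rep.{u} k (G × G)} {f f' : middleModule k G s ⟶ N}
    (h : ∀ t : Tuple G s, f.hom (middleElt k fun i => (t i).val) =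
      f'.hom (middleElt k fun i => (t i).val)) : f = f' := by
  -- the two morphisms agree on `1 ⊗ m`, hence on all translates of these elements
  have h1 : ∀ m : augPow k G s,
      f.hom (TensorProduct.tmul k (MonoidAlgebra.single (⟨1⟩ : TwoSided G) (1 : k)) m) =
        f'.hom (TensorProduct.tmul k (MonoidAlgebra.single (⟨1⟩ : TwoSided G) (1 : k)) m) := by
    intro m
    exact LinearMap.congr_fun (augPow_linearMap_ext
      (f := f.hom.toLinearMap ∘ₗ
        TensorProduct.mk k (twoSidedRep k G) (augPow k G s) (MonoidAlgebra.single ⟨1⟩ 1))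
      (f' := f'.hom.toLinearMap ∘ₗ
        TensorProduct.mk k (twoSidedRep k G) (augPow k G s) (MonoidAlgebra.single ⟨1⟩ 1))
      h) m
  refine Rep.hom_ext (Representation.IntertwiningMap.toLinearMap_injective _ _ ?_)
  refine TensorProduct.ext (M := twoSidedRep k G) (N := augPow k G s) ?_
  refine MonoidAlgebra.lhom_ext' fun x => LinearMap.ext_ring (LinearMap.ext fun m => ?_)
  change f.hom (TensorProduct.tmul k (MonoidAlgebra.single x 1) m) =
    f'.hom (TensorProduct.tmul k (MonoidAlgebra.single x 1) m)
  have h2 : (TensorProduct.tmul k (MonoidAlgebra.single x (1 : k)) m : middleModule k G s) =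
      (middleModule k G s).ρ (x.val, 1) (TensorProduct.tmul k (MonoidAlgebra.single ⟨1⟩ 1)
        ((augPow k G s).ρ (x.val, 1)⁻¹ m)) := by
    rw [middleModule_ρ_tmul, twoSidedRep_ρ_single, Representation.self_inv_apply]
    simp [TwoSided.smul_def]
  refine (congrArg f.hom h2).trans ((Rep.hom_comm_apply f _ _).trans (Eq.trans ?_
    ((Rep.hom_comm_apply f' _ _).symm.trans (congrArg f'.hom h2).symm)))
  exact congrArg (N.ρ (x.val, 1)) (h1 _)

/-- A family of elements of `N` which is equivariant under conjugation by `G` extends to a morphism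
of `G²`-modules. -/
theorem exists_middleModule_hom {N : Rep.{u} k (G × G)} (v : Tuple G s → N)
    (hv : ∀ (g : G) (t : Tuple G s), v (g • t) = N.ρ (g, g) (v t)) :
    ∃ f : middleModule k G s ⟶ N,
      ∀ t : Tuple G s, f.hom (middleElt k fun i => (t i).val) = v t := by
  obtain ⟨ψ, hψ⟩ := exists_augPow_linearMap (k := k) v
  have h1 : ∀ (g : G) (m : augPow k G s), ψ ((augPow k G s).ρ (g, g) m) = N.ρ (g, g) (ψ m) := by
    intro g m
    refine LinearMap.congr_fun (augPow_linearMap_ext (f := ψ ∘ₗ (augPow k G s).ρ (g, g))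
      (f' := N.ρ (g, g) ∘ₗ ψ) fun t => ?_) m
    change ψ ((augPow k G s).ρ (g, g) _) = N.ρ (g, g) (ψ _)
    rw [basisTensor_smul, hψ, ← hv, ← hψ]
    rfl
  -- equivariance forces `x ⊗ m = (x, 1) (1 ⊗ (x, 1)⁻¹ m) ↦ (x, 1) ψ((x, 1)⁻¹ m)`
  let F : MonoidAlgebra k (TwoSided G) →ₗ[k] augPow k G s →ₗ[k] N :=
    (Finsupp.lift _ _ _ fun x : TwoSided G =>
      N.ρ (x.val, 1) ∘ₗ ψ ∘ₗ (augPow k G s).ρ (x.val, 1)⁻¹) ∘ₗ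
      (MonoidAlgebra.coeffLinearEquiv k).toLinearMap
  have hF : ∀ x m, F (MonoidAlgebra.single x 1) m =
      N.ρ (x.val, 1) (ψ ((augPow k G s).ρ (x.val, 1)⁻¹ m)) := fun x m => by
    simp [F]
  let f : middleModule k G s ⟶ N := Rep.ofHom
    ⟨TensorProduct.lift (M := twoSidedRep k G) (N := augPow k G s) F, fun p => by
      refine TensorProduct.ext (M := twoSidedRep k G) (N := augPow k G s) ?_
      refine MonoidAlgebra.lhom_ext' fun x => LinearMap.ext_ring (LinearMap.ext fun m => ?_)
      change F ((twoSidedRep k G).ρ p (MonoidAlgebra.single x 1)) ((augPow k G s).ρ p m) =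
        N.ρ p (F (MonoidAlgebra.single x 1) m)
      rw [twoSidedRep_ρ_single, hF, hF, ← Module.End.mul_apply, ← map_mul]
      have h2 : ((p • x).val, (1 : G))⁻¹ * p = (p.2, p.2) * (x.val, 1)⁻¹ := by
        simp [TwoSided.smul_def, Prod.ext_iff, mul_assoc]
      have h3 : ((p • x).val, (1 : G)) * (p.2, p.2) = p * (x.val, 1) := by
        simp [TwoSided.smul_def, Prod.ext_iff, mul_assoc]
      rw [h2, map_mul, Module.End.mul_apply, h1, ← Module.End.mul_apply, ← map_mul, h3, map_mul]
      rfl⟩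
  refine ⟨f, fun t => ?_⟩
  refine (hF ⟨1⟩ _).trans ?_
  have h3 : (((⟨1⟩ : TwoSided G).val, 1) : G × G) = 1 := rfl
  rw [h3, inv_one, map_one, map_one, Module.End.one_apply, Module.End.one_apply, hψ]

theorem mem_tupleCentralizer_iff (t : Tuple G s) (g : G) :
    g ∈ tupleCentralizer t ↔ g • t = t := by
  rw [tupleCentralizer, Subgroup.mem_centralizer_iff, Set.forall_mem_range, funext_iff]
  refine forall_congr' fun i => ?_
  rw [NontrivialElt.ext_iff, Pi.smul_apply, NontrivialElt.smul_val, mul_inv_eq_iff_eq_mul, eq_comm]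

theorem tupleCentralizer_conj (t : Tuple G s) (c : tupleCentralizer t) (i : Fin s) :
    (tupleCentralizer t).subtype c * (t i).val * ((tupleCentralizer t).subtype c)⁻¹ = (t i).val :=
  congrArg NontrivialElt.val (congrFun ((mem_tupleCentralizer_iff t c.1).1 c.2) i)

/-- The universal property of `k[G] ⊗ I_G^{⊗ s}`: it is the coproduct, over the conjugation orbits
of tuples, of the modules induced from the trivial modules of the centralizers. -/
theorem middleUnit_comp_bijective
    (σ : MulAction.orbitRel.Quotient G (Tuple G s) → Tuple G s)
    (hσ : ∀ O, Quotient.mk (MulAction.orbitRel G (Tuple G s)) (σ O) = O)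
    (N : Rep.{u} k (G × G)) :
    Function.Bijective fun (f : middleModule k G s ⟶ N) O =>
      middleUnit k (tupleCentralizer (σ O)).subtype (fun i => (σ O i).val)
          (tupleCentralizer_conj (σ O)) ≫
        (Rep.resFunctor ((diag G).comp (tupleCentralizer (σ O)).subtype)).map f := by
  have h0 : ∀ t, ∃ g : G, g • σ (Quotient.mk _ t) = t := fun t =>
    MulAction.orbitRel_apply.1 (Quotient.exact (hσ (Quotient.mk _ t)).symm)
  have happ : ∀ (f : middleModule k G s ⟶ N) O, (middleUnit k (tupleCentralizer (σ O)).subtype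
      (fun i => (σ O i).val) (tupleCentralizer_conj (σ O)) ≫ (Rep.resFunctor
        ((diag G).comp (tupleCentralizer (σ O)).subtype)).map f).hom (1 : k) =
      f.hom (middleElt k fun i => (σ O i).val) := fun f O =>
    congrArg f.hom (one_smul k _)
  choose g hg using h0
  constructor
  · intro f f' h
    refine middleModule_hom_ext fun t => ?_
    have h1 := congrArg (fun p => p.hom (1 : k)) (congrFun h (Quotient.mk _ t))
    replace h1 := (happ f _).symm.trans (h1.trans (happ f' _))
    have h2 : (middleElt k fun i => (t i).val) =
        (middleModule k G s).ρ (g t, g t) (middleElt k fun i => (σ (Quotient.mk _ t) i).val) := by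
      rw [middleElt_smul]
      exact congrArg (fun t : Tuple G s => middleElt k fun i => (t i).val) (hg t).symm
    rw [h2, Rep.hom_comm_apply, Rep.hom_comm_apply, h1]
  · intro n
    let v : Tuple G s → N := fun t => N.ρ (g t, g t) ((n (Quotient.mk _ t)).hom (1 : k))
    -- the values of `n` are invariant under the centralizers
    have hn : ∀ O (c : G), c • σ O = σ O → N.ρ (c, c) ((n O).hom (1 : k)) = (n O).hom (1 : k) :=
      fun O c hc => (Rep.hom_comm_apply (n O) ⟨c, (mem_tupleCentralizer_iff _ _).2 hc⟩ (1 : k)).symm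
    have hv1 : ∀ O (c : G) t, c • σ O = t → v t = N.ρ (c, c) ((n O).hom (1 : k)) := by
      rintro O c t rfl
      have hO : Quotient.mk (MulAction.orbitRel G (Tuple G s)) (c • σ O) = O :=
        (Quotient.sound (MulAction.orbitRel_apply.2 ⟨c, rfl⟩)).trans (hσ O)
      have h1 := hg (c • σ O)
      change N.ρ (g (c • σ O), g (c • σ O)) ((n (Quotient.mk _ (c • σ O))).hom (1 : k)) = _
      rw [hO] at h1 ⊢
      have h2 := hn O (c⁻¹ * g (c • σ O)) (by rw [mul_smul, h1, inv_smul_smul])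
      conv_rhs => rw [← h2, ← Module.End.mul_apply, ← map_mul]
      simp
    have hv : ∀ (c : G) (t : Tuple G s), v (c • t) = N.ρ (c, c) (v t) := by
      intro c t
      rw [hv1 (Quotient.mk _ t) (c * g t) _ (by rw [mul_smul, hg])]
      change _ = N.ρ (c, c) (N.ρ (g t, g t) _)
      rw [← Module.End.mul_apply, ← map_mul]
      rfl
    obtain ⟨f, hf⟩ := exists_middleModule_hom v hv
    refine ⟨f, funext fun O => ?_⟩
    refine Rep.hom_ext (Representation.IntertwiningMap.toLinearMap_injective _ _
      (LinearMap.ext_ring ?_))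
    refine (happ f O).trans ?_
    rw [hf, hv1 O 1 _ (one_smul _ _)]
    change N.ρ 1 _ = _
    rw [map_one]
    rfl

end UniversalProperty

/-! ### The projections and the induced map as restrictions of extension classes -/

section Restriction
open Abelian MonoidalCategory
variable {k Γ L K : Type u} [CommRing k] [Group Γ] [Group L] [Group K]

/-- Translation by `g`, as a natural transformation between two iterated restrictions which agree up
to conjugation by `g`. -/
def resTranslate (β : L →* Γ) (δ : K →* L) (β' : K →* Γ) (g : Γ)
    (h : ∀ c, β' c * g = g * β (δ c)) :
    (Rep.resFunctor β ⋙ Rep.resFunctor δ : Rep.{u} k Γ ⥤ Rep.{u} k K) ⟶ Rep.resFunctor β' where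
  app M := Rep.ofHom ⟨M.ρ g, fun c => by
    change M.ρ g * M.ρ (β (δ c)) = M.ρ (β' c) * M.ρ g
    rw [← map_mul, ← map_mul, h]⟩
  naturality M N f := Rep.hom_ext (Representation.IntertwiningMap.toLinearMap_injective _ _
    (LinearMap.ext fun m => (Rep.hom_comm_apply f g m).symm))

/-- Two successive restrictions of an extension class with trivial coefficients amount to a single
one, and translating by an element `g` does not matter. -/
theorem extPullback_extPullback (β : L →* Γ) (δ : K →* L) (β' : K →* Γ) (g : Γ)
    (h : ∀ c, β' c * g = g * β (δ c)) {X : Rep.{u} k Γ} {Y : Rep.{u} k L} {Z : Rep.{u} k K}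
    (u : Y ⟶ (Rep.resFunctor β).obj X) (w : Z ⟶ (Rep.resFunctor δ).obj Y)
    (w' : Z ⟶ (Rep.resFunctor β').obj X) (hw : ∀ z, w'.hom z = X.ρ g (u.hom (w.hom z)))
    (A : Type u) [AddCommGroup A] [Module k A] (n : ℕ) (e : Ext X (Rep.trivial k Γ A) n) :
    (extPullback (Rep.resFunctor δ) w ((Rep.resFunctor β).obj (Rep.trivial k Γ A)) n
        (extPullback (Rep.resFunctor β) u (Rep.trivial k Γ A) n e) : Ext Z (Rep.trivial k K A) n) =
      extPullback (Rep.resFunctor β') w' (Rep.trivial k Γ A) n e := by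
  have h1 := extPullback_extPullback_comp (Rep.resFunctor β) (Rep.resFunctor δ) (Rep.resFunctor β')
    (resTranslate (k := k) β δ β' g h) u w (Rep.trivial k Γ A) n e
  have h3 : w ≫ (Rep.resFunctor δ).map u ≫ (resTranslate (k := k) β δ β' g h).app X = w' :=
    Rep.hom_ext (Representation.IntertwiningMap.toLinearMap_injective _ _
      (LinearMap.ext fun m => (hw m).symm))
  rw [h3] at h1
  -- the translation acts as the identity on the trivial module
  exact (Ext.comp_mk₀_id _).symm.trans h1

/-- `Φ_α`, precomposed with the pullback along the adjoint of a morphism `u`. -/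
theorem extPhi_extPre_homEquiv_symm (α : L →* Γ) {M : Rep.{u} k L} {X : Rep.{u} k Γ}
    (u : M ⟶ (Rep.resFunctor α).obj X) (N : Rep.{u} k Γ) (n : ℕ) (e : Ext X N n) :
    extPhi α M N n (extPre (((Rep.indResAdjunction.{u} k α).homEquiv _ _).symm u) N n e) =
      extPullback (Rep.resFunctor α) u N n e := by
  have h := extPullback_comp_mk₀ (Rep.resFunctor α) ((Rep.indResAdjunction.{u} k α).unit.app M)
    (((Rep.indResAdjunction.{u} k α).homEquiv M X).symm u) n e
  have h2 := ((Rep.indResAdjunction.{u} k α).homEquiv_unit M X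
    (((Rep.indResAdjunction.{u} k α).homEquiv M X).symm u)).symm.trans (Equiv.apply_symm_apply _ u)
  exact h.trans (congrArg (fun v => extPullback (Rep.resFunctor α) v N n e) h2)

theorem middleMap_apply {G H : Type u} [Group G] [Group H] (α : H →* G)
    (A : Type u) [AddCommGroup A] [Module k A] (s r : ℕ)
    (e : Ext (middleModule k G s) (Rep.trivial k (G × G) A) r) :
    middleMap k α A s r e =
      extPullback (Rep.resFunctor (sq α)) (middleHom k α s) (Rep.trivial k (G × G) A) r e := by
  have h := extPullback_comp_mk₀ (Rep.resFunctor (sq α))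
    ((Rep.indResAdjunction.{u} k (sq α)).unit.app _)
    ((Rep.indResAdjunction.{u} k (sq α)).counit.app (middleModule k G s)) r e
  rw [Adjunction.right_triangle_components] at h
  have h2 := mk₀_comp_extPullback (Rep.resFunctor (sq α)) (middleHom k α s) (𝟙 _)
    (Rep.trivial k (G × G) A) r e
  rw [Category.comp_id] at h2
  exact (congrArg (fun x => (Ext.mk₀ (middleHom k α s)).comp x (zero_add r)) h).trans h2

end Restriction

section Projections
open Abelian MonoidalCategory
variable {k G H K : Type u} [CommRing k] [Group G] [Group H] [Group K]
  (A : Type u) [AddCommGroup A] [Module k A] {s : ℕ} (r : ℕ)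

/-- The restriction of an extension class of `k[G] ⊗ I_G^{⊗ s}` along `K → G → G²`, pulled back
along `1 ↦ 1 ⊗ (t₁ - 1) ⊗ ⋯ ⊗ (t_s - 1)`. -/
def tupleRes (γ : K →* G) (t : Fin s → G) (h : ∀ c i, γ c * t i * (γ c)⁻¹ = t i) :
    Ext (middleModule k G s) (Rep.trivial k (G × G) A) r →+
      Ext (Rep.trivial k K k) (Rep.trivial k K A) r :=
  extPullback (Rep.resFunctor ((diag G).comp γ)) (middleUnit k γ t h) (Rep.trivial k (G × G) A) r

theorem diagIso_apply (e : Ext (middleModule k G s) (Rep.trivial k (G × G) A) r) :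
    diagIso k A s r e = extPullback (Rep.resFunctor (diag G)) (diagUnit k G (augPow k G s))
      (Rep.trivial k (G × G) A) r e :=
  extPhi_extPre_homEquiv_symm (diag G) (diagUnit k G (augPow k G s)) (Rep.trivial k (G × G) A) r e

theorem groupCohomologyAddEquivExt_orbitIso (a : Tuple G s)
    (x : Ext (orbitRep k a) (Rep.trivial k G A) r) :
    groupCohomologyAddEquivExt (Rep.trivial k (tupleCentralizer a) A) r (orbitIso k A a r x) =
      extPullback (Rep.resFunctor (tupleCentralizer a).subtype) (orbitUnit k a)
        (Rep.trivial k G A) r x :=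
  ((groupCohomologyAddEquivExt (Rep.trivial k (tupleCentralizer a) A) r).apply_symm_apply _).trans
    (extPhi_extPre_homEquiv_symm (tupleCentralizer a).subtype (orbitUnit k a) (Rep.trivial k G A) r
      x)

theorem orbitIncl_orbitUnit (a : Tuple G s) (z : k) :
    (diagUnit k G (augPow k G s)).hom ((orbitIncl k a).hom ((orbitUnit k a).hom z)) =
      z • middleElt k (fun i => (a i).val) := by
  have h3 : (orbitUnit k a).hom z =
      z • (MonoidAlgebra.single ⟨a, MulAction.mem_orbit_self a⟩ (1 : k) : orbitRep k a) := rfl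
  have h4 : (orbitIncl k a).hom (MonoidAlgebra.single ⟨a, MulAction.mem_orbit_self a⟩ (1 : k)) =
      basisTensor k s fun i => (a i).val := by
    change Finsupp.linearCombination k (fun o : MulAction.orbit G a =>
      basisTensor k s (fun i => (o.1 i).val)) (Finsupp.single _ 1) = _
    rw [Finsupp.linearCombination_single, one_smul]
  rw [h3]
  refine (congrArg (diagUnit k G (augPow k G s)).hom ((map_smul (orbitIncl k a).hom z _).trans
    (congrArg (z • ·) h4))).trans ?_
  exact map_smul (diagUnit k G (augPow k G s)).hom z _

/-- The projection `q_a` is a single restriction to the centralizer of `a`. -/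
theorem groupCohomologyAddEquivExt_summandProj (a : Tuple G s)
    (e : Ext (middleModule k G s) (Rep.trivial k (G × G) A) r) :
    groupCohomologyAddEquivExt (Rep.trivial k (tupleCentralizer a) A) r (summandProj k A a r e) =
      tupleRes A r (tupleCentralizer a).subtype (fun i => (a i).val) (tupleCentralizer_conj a)
        e := by
  refine (groupCohomologyAddEquivExt_orbitIso A r a _).trans ?_
  refine (extPullback_comp_mk₀ (Rep.resFunctor (tupleCentralizer a).subtype) (orbitUnit k a)
    (orbitIncl k a) r (diagIso k A s r e)).trans ?_
  rw [diagIso_apply]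
  exact extPullback_extPullback (diag G) (tupleCentralizer a).subtype
    ((diag G).comp (tupleCentralizer a).subtype) 1
    (fun c => by rw [mul_one, one_mul]; rfl) (diagUnit k G (augPow k G s))
    (orbitUnit k a ≫ (Rep.resFunctor (tupleCentralizer a).subtype).map (orbitIncl k a))
    (middleUnit k (tupleCentralizer a).subtype (fun i => (a i).val) (tupleCentralizer_conj a))
    (fun z => by
      rw [map_one]
      exact (orbitIncl_orbitUnit a z).symm) A r e

theorem augIdealMap_subOne (α : H →* G) (x : H) :
    (augIdealMap k α).hom (subOne k x) = subOne k (α x) := by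
  refine Subtype.ext ?_
  change groupRingMap k α (MonoidAlgebra.single ⟨x⟩ 1 - MonoidAlgebra.single ⟨1⟩ 1) =
    MonoidAlgebra.single ⟨α x⟩ 1 - MonoidAlgebra.single ⟨1⟩ 1
  simp [groupRingMap, TwoSided.map]

theorem augPowMap_basisTensor (α : H →* G) : ∀ {s : ℕ} (t : Fin s → H),
    (augPowMap k α s).hom (basisTensor k s t) = basisTensor k s fun i => α (t i)
  | 0, _ => rfl
  | _ + 1, t => congrArg₂ (TensorProduct.tmul k) (augIdealMap_subOne α (t 0))
      (augPowMap_basisTensor α (Fin.tail t))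

theorem middleHom_middleElt (α : H →* G) (t : Fin s → H) :
    (middleHom k α s).hom (middleElt k t) = middleElt k fun i => α (t i) := by
  refine congrArg₂ (TensorProduct.tmul k) ?_ (augPowMap_basisTensor α t)
  change groupRingMap k α (MonoidAlgebra.single ⟨1⟩ 1) = _
  simp [groupRingMap, TwoSided.map]

/-- Pulling back along the map induced by `α` replaces the tuple `t` by `α(t)`. -/
theorem tupleRes_middleMap (α : H →* G) (γ : K →* H) (t : Fin s → H)
    (h : ∀ c i, γ c * t i * (γ c)⁻¹ = t i)
    (h' : ∀ c i, α.comp γ c * α (t i) * (α.comp γ c)⁻¹ = α (t i))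
    (e : Ext (middleModule k G s) (Rep.trivial k (G × G) A) r) :
    tupleRes A r γ t h (middleMap k α A s r e) =
      tupleRes A r (α.comp γ) (fun i => α (t i)) h' e := by
  rw [middleMap_apply]
  refine extPullback_extPullback (sq α) ((diag H).comp γ) ((diag G).comp (α.comp γ)) 1
    (fun c => by rw [mul_one, one_mul]; rfl) _ _ _ (fun z => ?_) A r e
  rw [map_one]
  change z • middleElt k (fun i => α (t i)) = (middleHom k α s).hom (z • middleElt k t)
  rw [map_smul, middleHom_middleElt]

/-- A tuple with a trivial entry contributes nothing, since `1 - 1 = 0`. -/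
theorem tupleRes_of_eq_one (γ : K →* G) (t : Fin s → G) (h : ∀ c i, γ c * t i * (γ c)⁻¹ = t i)
    (i : Fin s) (hi : t i = 1) : tupleRes (k := k) A r γ t h = 0 := by
  have h1 : middleUnit k γ t h = 0 :=
    Rep.hom_ext (Representation.IntertwiningMap.toLinearMap_injective _ _
      (LinearMap.ext fun x => by
        refine (middleUnit_apply γ t h x).trans ?_
        rw [middleElt, basisTensor_eq_zero t i hi, TensorProduct.tmul_zero]
        exact smul_zero (A := middleModule k G s) (M := k) x))
  rw [tupleRes, h1]
  exact extPullback_zero _ _ _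

/-- The restriction to a group mapping to the centralizer of a conjugate of `a` factors through
`q_a`. -/
theorem tupleRes_conj (a : Tuple G s) (γ : K →* G) (t : Fin s → G)
    (h : ∀ c i, γ c * t i * (γ c)⁻¹ = t i) (g : G) (hg : ∀ i, t i = g * (a i).val * g⁻¹)
    (δ : K →* tupleCentralizer a) (hδ : ∀ c, γ c * g = g * δ c)
    (e : Ext (middleModule k G s) (Rep.trivial k (G × G) A) r) :
    tupleRes A r γ t h e =
      extPullback (Rep.resFunctor δ) (trivialRes k δ k) (Rep.trivial k (tupleCentralizer a) A) r
        (groupCohomologyAddEquivExt (Rep.trivial k (tupleCentralizer a) A) r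
          (summandProj k A a r e)) := by
  rw [groupCohomologyAddEquivExt_summandProj]
  refine (extPullback_extPullback ((diag G).comp (tupleCentralizer a).subtype) δ
    ((diag G).comp γ) (g, g) (fun c => Prod.ext (hδ c) (hδ c)) _ _ _ (fun z => ?_) A r e).symm
  change z • middleElt k t =
    (middleModule k G s).ρ (g, g) (z • middleElt k fun i => (a i).val)
  rw [map_smul, middleElt_smul, funext hg]

end Projections

/-! ### The decomposition over conjugation orbits and the components of the induced map -/

section Decomposition
open Abelian MonoidalCategory
variable {k G H : Type u} [CommRing k] [Group G] [Group H]
  (A : Type u) [AddCommGroup A] [Module k A] {s : ℕ} (r : ℕ)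

theorem orbitDecomposition_bijective
    (σ : MulAction.orbitRel.Quotient G (Tuple G s) → Tuple G s)
    (hσ : ∀ O, Quotient.mk (MulAction.orbitRel G (Tuple G s)) (σ O) = O) :
    Function.Bijective (orbitDecomposition k A σ r) := by
  have : ∀ O, (Rep.resFunctor ((diag G).comp (tupleCentralizer (σ O)).subtype) :
      Rep.{u} k (G × G) ⥤ Rep.{u} k (tupleCentralizer (σ O))).PreservesInjectiveObjects := fun O =>
    resFunctor_preservesInjectiveObjects _ fun _ _ h => Subtype.ext (congrArg Prod.fst h)
  have h1 := extPullback_bijective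
    (fun O => Rep.resFunctor ((diag G).comp (tupleCentralizer (σ O)).subtype))
    (fun O => middleUnit k (tupleCentralizer (σ O)).subtype (fun i => (σ O i).val)
      (tupleCentralizer_conj (σ O))) (middleUnit_comp_bijective σ hσ) (Rep.trivial k (G × G) A) r
  have h2 : Function.Bijective (AddMonoidHom.piMap fun O =>
      (groupCohomologyAddEquivExt (Rep.trivial k (tupleCentralizer (σ O)) A) r).toAddMonoidHom) :=
    Function.Bijective.piMap fun O => (groupCohomologyAddEquivExt _ r).bijective
  refine (Function.Bijective.of_comp_iff' h2 _).1 ?_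
  have h3 : ⇑(AddMonoidHom.piMap fun O => (groupCohomologyAddEquivExt
      (Rep.trivial k (tupleCentralizer (σ O)) A) r).toAddMonoidHom) ∘ orbitDecomposition k A σ r =
      fun e O => tupleRes A r (tupleCentralizer (σ O)).subtype (fun i => (σ O i).val)
        (tupleCentralizer_conj (σ O)) e :=
    funext fun e => funext fun O => groupCohomologyAddEquivExt_summandProj A r (σ O) e
  rw [h3]
  exact h1

/-- The vanishing of `q_t(e)` depends only on the orbit of `t`. -/
theorem summandProj_eq_zero_of_mem_orbit {a t : Tuple G s} (ht : t ∈ MulAction.orbit G a)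
    {e : Ext (middleModule k G s) (Rep.trivial k (G × G) A) r} (he : summandProj k A a r e = 0) :
    summandProj k A t r e = 0 := by
  obtain ⟨g, rfl⟩ := ht
  let δ : tupleCentralizer (g • a) →* tupleCentralizer a :=
    ((MulAut.conj g⁻¹).toMonoidHom.comp (tupleCentralizer (g • a)).subtype).codRestrict _ (by
      intro c
      have h := (mem_tupleCentralizer_iff _ _).1 c.2
      refine (mem_tupleCentralizer_iff _ _).2 ?_
      change (g⁻¹ * c.1 * g⁻¹⁻¹) • a = a
      rw [inv_inv, mul_smul, mul_smul, h, inv_smul_smul])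
  have h1 := tupleRes_conj A r a (tupleCentralizer (g • a)).subtype (fun i => ((g • a) i).val)
    (tupleCentralizer_conj (g • a)) g (fun i => rfl) δ (fun c => by
      change c.1 * g = g * (g⁻¹ * c.1 * g⁻¹⁻¹)
      group) e
  rw [← groupCohomologyAddEquivExt_summandProj, he, map_zero, map_zero] at h1
  exact (map_eq_zero_iff _ (groupCohomologyAddEquivExt _ r).injective).1 h1

theorem existsUnique_isSummandIncl
    (σ : MulAction.orbitRel.Quotient G (Tuple G s) → Tuple G s)
    (hσ : ∀ O, Quotient.mk (MulAction.orbitRel G (Tuple G s)) (σ O) = O)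
    (O : MulAction.orbitRel.Quotient G (Tuple G s)) : ∃! j, IsSummandIncl k A (σ O) r j := by
  classical
  have hbij := orbitDecomposition_bijective (k := k) A r σ hσ
  let E := AddEquiv.ofBijective (orbitDecomposition k A σ r) hbij
  let S := AddMonoidHom.single
    (fun O => groupCohomology (Rep.trivial k (tupleCentralizer (σ O)) A) r) O
  have hE : ∀ x O', summandProj k A (σ O') r (E.symm (S x)) = S x O' := fun x O' =>
    congrFun (E.apply_symm_apply (S x)) O'
  have hS : ∀ x, S x O = x := fun x => Pi.single_eq_same (M := fun O => groupCohomology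
    (Rep.trivial k (tupleCentralizer (σ O)) A) r) O x
  have hS' : ∀ x O', O' ≠ O → S x O' = 0 := fun x O' h => Pi.single_eq_of_ne (M := fun O =>
    groupCohomology (Rep.trivial k (tupleCentralizer (σ O)) A) r) h x
  have hmem : ∀ t : Tuple G s, t ∈ MulAction.orbit G (σ (Quotient.mk _ t)) := fun t =>
    MulAction.orbitRel_apply.1 (Quotient.exact (hσ (Quotient.mk _ t)).symm)
  refine ⟨E.symm.toAddMonoidHom.comp S, ⟨?_, fun t ht => ?_⟩, fun j hj => ?_⟩
  · exact AddMonoidHom.ext fun x => (hE x O).trans (hS x)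
  · refine AddMonoidHom.ext fun x => summandProj_eq_zero_of_mem_orbit A r (hmem t) ((hE x _).trans
      (hS' x _ fun h => ht ?_))
    rw [← h]
    exact hmem t
  · refine AddMonoidHom.ext fun x => hbij.1 (funext fun O' => ?_)
    change summandProj k A (σ O') r (j x) = summandProj k A (σ O') r (E.symm (S x))
    rw [hE]
    by_cases h : O' = O
    · subst h
      exact (DFunLike.congr_fun hj.1 x).trans (hS x).symm
    · refine (DFunLike.congr_fun (hj.2 (σ O') fun h' => h ?_) x).trans (hS' x O' h).symm
      rw [← hσ O', ← hσ O]
      exact Quotient.sound (MulAction.orbitRel_apply.2 h')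

theorem exists_section_orbitRel (a : Tuple G s) :
    ∃ σ : MulAction.orbitRel.Quotient G (Tuple G s) → Tuple G s,
      (∀ O, Quotient.mk (MulAction.orbitRel G (Tuple G s)) (σ O) = O) ∧
      σ (Quotient.mk (MulAction.orbitRel G (Tuple G s)) a) = a := by
  classical
  refine ⟨Function.update Quotient.out (Quotient.mk _ a) a, fun O => ?_, Function.update_self _ _ _⟩
  by_cases h : O = Quotient.mk _ a
  · subst h
    rw [Function.update_self]
  · rw [Function.update_of_ne h, Quotient.out_eq]

variable (α : H →* G)

/-- The component of the induced map at `b` is a restriction to the centralizer of `b`, mapped to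
`G` by `α`. -/
theorem groupCohomologyAddEquivExt_summandProj_middleMap (b : Tuple H s)
    (h : ∀ (c : tupleCentralizer b) (i : Fin s), α.comp (tupleCentralizer b).subtype c *
      α (b i).val * (α.comp (tupleCentralizer b).subtype c)⁻¹ = α (b i).val)
    (e : Ext (middleModule k G s) (Rep.trivial k (G × G) A) r) :
    groupCohomologyAddEquivExt (Rep.trivial k (tupleCentralizer b) A) r
        (summandProj k A b r (middleMap k α A s r e)) =
      tupleRes A r (α.comp (tupleCentralizer b).subtype) (fun i => α (b i).val) h e :=
  (groupCohomologyAddEquivExt_summandProj A r b _).trans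
    (tupleRes_middleMap A r α (tupleCentralizer b).subtype (fun i => (b i).val)
      (tupleCentralizer_conj b) h e)

theorem map_tupleCentralizer_conj (b : Tuple H s) (c : tupleCentralizer b) (i : Fin s) :
    α.comp (tupleCentralizer b).subtype c * α (b i).val *
      (α.comp (tupleCentralizer b).subtype c)⁻¹ = α (b i).val := by
  have h := congrArg α (tupleCentralizer_conj b c i)
  rwa [map_mul, map_mul, map_inv] at h

/-- If `α(b)` has a trivial entry, it is not an element of `(G ∖ {1})^s`, and the component of the
induced map at `b` vanishes. -/
theorem summandProj_middleMap_of_eq_one (b : Tuple H s) (i : Fin s) (hi : α (b i).val = 1)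
    (e : Ext (middleModule k G s) (Rep.trivial k (G × G) A) r) :
    summandProj k A b r (middleMap k α A s r e) = 0 := by
  refine (groupCohomologyAddEquivExt _ r).injective ?_
  rw [groupCohomologyAddEquivExt_summandProj_middleMap A r α b (map_tupleCentralizer_conj α b),
    tupleRes_of_eq_one A r _ _ _ i hi, map_zero]
  rfl

/-- If `α(b) = a`, the component of the induced map at `b` is `α^* ∘ q_a`. -/
theorem summandProj_middleMap {a : Tuple G s} {b : Tuple H s}
    (h : ∀ i, α (b i).val = (a i).val)
    (e : Ext (middleModule k G s) (Rep.trivial k (G × G) A) r) :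
    summandProj k A b r (middleMap k α A s r e) =
      centralizerRes k α A h r (summandProj k A a r e) := by
  refine (groupCohomologyAddEquivExt (Rep.trivial k (tupleCentralizer b) A) r).injective ?_
  rw [groupCohomologyAddEquivExt_summandProj_middleMap A r α b (map_tupleCentralizer_conj α b)]
  refine (tupleRes_conj A r a (α.comp (tupleCentralizer b).subtype) (fun i => α (b i).val)
    (map_tupleCentralizer_conj α b) 1 (fun i => by rw [h, one_mul, inv_one, mul_one])
    (centralizerMap α h) (fun c => by rw [mul_one, one_mul]; rfl) e).trans ?_
  exact (groupCohomologyAddEquivExt_map (centralizerMap α h)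
    (Rep.trivial k (tupleCentralizer a) A) r (summandProj k A a r e)).symm

theorem component_eq_zero {a : Tuple G s} {b : Tuple H s}
    {j : groupCohomology (Rep.trivial k (tupleCentralizer a) A) r →+
      Ext (middleModule k G s) (Rep.trivial k (G × G) A) r} (hj : IsSummandIncl k A a r j)
    (h : ¬ ∃ g : G, ∀ i, α (b i).val = g * (a i).val * g⁻¹) : component k α A b r j = 0 := by
  refine AddMonoidHom.ext fun x => ?_
  by_cases hb : ∃ i, α (b i).val = 1
  · obtain ⟨i, hi⟩ := hb
    exact summandProj_middleMap_of_eq_one A r α b i hi (j x)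
  · have hb' : ∀ i, α (b i).val ≠ 1 := fun i hi => hb ⟨i, hi⟩
    refine (summandProj_middleMap A r α (a := fun i => ⟨α (b i).val, hb' i⟩) (b := b) (fun i => rfl)
      (j x)).trans ?_
    have h1 := DFunLike.congr_fun (hj.2 (fun i => ⟨α (b i).val, hb' i⟩) (by
      rintro ⟨g, hg⟩
      exact h ⟨g, fun i => (congrArg NontrivialElt.val (congrFun hg i)).symm⟩)) x
    exact (congrArg _ h1).trans (map_zero _)

theorem component_eq_centralizerRes {a : Tuple G s} {b : Tuple H s}
    {j : groupCohomology (Rep.trivial k (tupleCentralizer a) A) r →+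
      Ext (middleModule k G s) (Rep.trivial k (G × G) A) r} (hj : IsSummandIncl k A a r j)
    (h : ∀ i, α (b i).val = (a i).val) :
    component k α A b r j = centralizerRes k α A h r :=
  AddMonoidHom.ext fun x => (summandProj_middleMap A r α h (j x)).trans
    (congrArg _ (DFunLike.congr_fun hj.1 x))

end Decomposition

end TCExt
end

theorem theorem4p6 (k : Type u) [CommRing k] {G H : Type u} [Group G] [Group H] (α : H →* G)
    (A : Type u) [AddCommGroup A] [Module k A] (s r : ℕ) :
    (∀ σ : MulAction.orbitRel.Quotient G (TCExt.Tuple G s) → TCExt.Tuple G s,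
      (∀ O, Quotient.mk (MulAction.orbitRel G (TCExt.Tuple G s)) (σ O) = O) →
        Function.Bijective (TCExt.orbitDecomposition k A σ r)) ∧
    (∀ σ : MulAction.orbitRel.Quotient H (TCExt.Tuple H s) → TCExt.Tuple H s,
      (∀ O, Quotient.mk (MulAction.orbitRel H (TCExt.Tuple H s)) (σ O) = O) →
        Function.Bijective (TCExt.orbitDecomposition k A σ r)) ∧
    ∀ (a : TCExt.Tuple G s) (b : TCExt.Tuple H s),
      (∃! j, TCExt.IsSummandIncl k A a r j) ∧
      ∀ j, TCExt.IsSummandIncl k A a r j →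
        ((¬ ∃ g : G, ∀ i, α (b i).val = g * (a i).val * g⁻¹) →
          TCExt.component k α A b r j = 0) ∧
        (∀ h : ∀ i, α (b i).val = (a i).val,
          TCExt.component k α A b r j = TCExt.centralizerRes k α A h r) := by
  refine ⟨TCExt.orbitDecomposition_bijective A r, TCExt.orbitDecomposition_bijective A r,
    fun a b => ⟨?_, fun j hj => ⟨TCExt.component_eq_zero A r α hj,
      TCExt.component_eq_centralizerRes A r α hj⟩⟩⟩
  obtain ⟨σ, hσ, ha⟩ := TCExt.exists_section_orbitRel a
  have h := TCExt.existsUnique_isSummandIncl (k := k) A r σ hσ (Quotient.mk _ a)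
  rwa [ha] at h
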